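/- **Setting.** For $\lambda\ge\sigma>0$ let $\mathcal D(\lambda,\sigma)$ be the set of all probability distributions $D$ on $\mathbb R$ with finite second moment, mean $\mu(D)\in[-\lambda,\lambda]$ and variance at most $\sigma^2$. A *1-bit mean estimator* draws i.i.d. samples from $D$ in rounds; it sees of each sample $X_t$ only one bit $Q_t(X_t)$, where the measurable map $Q_t:\mathbb R\to\{0,1\}$ may depend on internal randomness (independent of the samples) and on the bits received in earlier rounds. It then outputs $\hat\mu\in\mathbb R$. It is *$(\epsilon,\delta)$-PAC* for $\mathcal D(\lambda,\sigma)$ if $\Pr(|\hat\mu-\mu(D)|\le\epsilon)\ge1-\delta$ for every $D\in\mathcal D(\lambda,\sigma)$. An *interval query* is $Q=\mathbf 1_I$ with $I\subseteq\mathbb R$ an interval. **The two-stage estimator** (input $\lambda,\sigma,\epsilon,\delta$). *Round 1 (Gray-code localization).* For $x\in\mathbb R$ let $g_k(x)=1$ if $\lfloor 2^kx\rfloor\bmod 4\in\{1,2\}$ and $g_k(x)=0$ otherwise. Let $K=\max\{0,\lfloor\log_2(2\lambda/\sigma)-3\rfloor\}$ and $J=\lceil 8\log(3K/\delta)\rceil$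 (no samples are used if $K=0$). For $1\le k\le K$ the query $x\mapsto g_k\big(\tfrac{x+\lambda}{2\lambda}\big)$ is applied to $J$ fresh samples, and $\hat z_k$ is the majority of the $J$ bits (ties give $1$). Let $x_0=\inf\{x\in[0,1]:g_k(x)=\hat z_k,\ 1\le k\le K\}$, let $[L',U']=[x_0-2^{-(K+2)},\,x_0+2^{-K}+2^{-(K+2)}]\cap[0,1]$, and let $c=\lambda(L'+U')-\lambda$ be the midpoint of the interval $[2\lambda L'-\lambda,\,2\lambda U'-\lambda]$, whose length is at most $24\sigma$. *Round 2 (refinement).* Let $s=4\sigma$; $m_0=0$, $m_i=2^i$ for $1\le i\le4$, $m_i=2(m_{i-1}-3)$ for $i\ge5$; $R_i=[m_{i-1}s,m_is)$ and $R_{-i}=[-m_is,-m_{i-1}s)$ for $i\ge1$; and $i_{\max}=\min\{i\ge5:2^{-i}\le 5\epsilon/(128s)\}$. Put $\epsilon_i=\frac{\epsilon}{4i_{\max}(m_{i-1}+m_i)s}$, $\delta_0=\frac{\delta}{8i_{\max}}$, $n_i=\big\lceil\frac1{2\epsilon_i^2}\log\frac2{\delta_0}\big\rceil$ for $1\le i\le4$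 and $n_i=\big\lceil\big(\frac{8}{m_i^2\epsilon_i^2}+\frac2{3\epsilon_i}\big)\log\frac2{\delta_0}\big\rceil$ for $i\ge5$. For each $R=[a,b)\in\{R_i,R_{-i}\}$, $1\le i\le i_{\max}$, let $\hat p_a$ be the frequency of the answer $1$ over $n_i$ fresh samples to queries "$X-c\in[a,T]$?", and $\hat p_b$ that over $n_i$ further fresh samples to queries "$X-c\in[T,b)$?", with a fresh independent $T\sim\mathrm{Unif}(a,b)$ for each sample. The output is $\hat\mu=c+\sum_R(a\,\hat p_a+b\,\hat p_b)$. **Statement.** There is an absolute constant $C>0$ such that for all $\lambda\ge\sigma>0$, $\epsilon>0$ and $\delta\in(0,1)$: 1. the two-stage estimator is $(\epsilon,\delta)$-PAC for $\mathcal D(\lambda,\sigma)$; 2. if $\epsilon\le\sigma$, its number $n$ of samples satisfies $$n\le C\left(\frac{\sigma^2}{\epsilon^2}\Big(1+\log\frac\sigma\epsilon\Big)^3\log\frac{2+\log(\sigma/\epsilon)}{\delta}+\log\frac\lambda\sigma\cdot\log\frac{2+\log(\lambda/\sigma)}{\delta}\right),$$ that is, $n=\widetilde O\big(\frac{\sigma^2}{\epsilon^2}\log\frac1\delta+\log\frac\lambda\sigma\cdot\log\log\frac\lambda\sigma\big)$,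 where $\widetilde O$ hides factors that are polylogarithmic in $\sigma/\epsilon$ and in $1/\delta$; 3. it uses at most two rounds of adaptivity; every query of the first round is a non-interval 1-bit query, and every query of the second round is an interval query. -/

import Mathlib

open MeasureTheory ProbabilityTheory

noncomputable section

/-! ### 1-bit estimators -/

/-- A (possibly randomized) 1-bit mean estimator whose samples are labelled by the finite type `ι`.
Every sample `t` is queried in the round `round t`.  The 1-bit quantizer used on it may depend on the
internal randomness `ω` and on the answers received in strictly earlier rounds (`causal`).
(The earlier quantizers are themselves functions of `ω` and of these answers.)  The fully sequential
protocol is the case `ι = Fin n`, `round t = t`. -/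
structure OneBitEstimator (ι : Type) [Fintype ι] where
  /-- the space of the internal randomness -/
  Ω : Type
  mΩ : MeasurableSpace Ω
  /-- the law of the internal randomness -/
  law : Measure Ω
  isProb : IsProbabilityMeasure law
  round : ι → ℕ
  /-- `query t ω y` is the quantizer applied to sample `t`, given the answers `y` -/
  query : ι → Ω → (ι → Bool) → ℝ → Bool
  causal : ∀ t ω y y', (∀ s, round s < round t → y s = y' s) → query t ω y = query t ω y'
  measurable_query : ∀ t y, Measurable fun p : Ω × ℝ => query t p.1 y p.2
  /-- the estimate computed from the transcript -/
  estimate : Ω → (ι → Bool) → ℝ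
  measurable_estimate : ∀ y, Measurable fun ω => estimate ω y

attribute [instance] OneBitEstimator.mΩ OneBitEstimator.isProb

namespace OneBitEstimator

variable {ι : Type} [Fintype ι]

/-- The bit sent for sample `t`, when the internal randomness is `ω` and the samples are `x`. -/
def answer (E : OneBitEstimator ι) (ω : E.Ω) (x : ι → ℝ) (t : ι) : Bool :=
  E.query t ω (fun s => if E.round s < E.round t then E.answer ω x s else false) (x t)
termination_by E.round t

/-- The value returned by the estimator. -/
def output (E : OneBitEstimator ι) (ω : E.Ω) (x : ι → ℝ) : ℝ :=
  E.estimate ω (E.answer ω x)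

/-- The number of samples (each of them is queried exactly once). -/
def numSamples (_E : OneBitEstimator ι) : ℕ := Fintype.card ι

/-- The number of rounds of adaptivity. -/
def numRounds (E : OneBitEstimator ι) : ℕ := (Finset.univ.image E.round).card

/-- `(ε, δ)`-PAC for the family `𝒟`: for every `D ∈ 𝒟`, on i.i.d. samples from `D` and independent
internal randomness, the output is `ε`-close to the mean of `D` with probability at least `1 - δ`. -/
def IsPAC (E : OneBitEstimator ι) (𝒟 : Set (Measure ℝ)) (ε δ : ℝ) : Prop :=
  ∀ D ∈ 𝒟, ENNReal.ofReal (1 - δ) ≤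
    (E.law.prod (Measure.pi fun _ : ι => D)) {p | |E.output p.1 p.2 - ∫ x, x ∂D| ≤ ε}

end OneBitEstimator

/-- An interval query asks whether the sample lies in an interval
(bounded or not; each endpoint may be included or not). -/
def IsIntervalQuery (q : ℝ → Bool) : Prop := {x | q x = true}.OrdConnected

/-- The distributions on `ℝ` with mean in `[-lam, lam]` and variance at most `σ²`. -/
def meanVarFamily (lam σ : ℝ) : Set (Measure ℝ) :=
  {D | IsProbabilityMeasure D ∧ MemLp id 2 D ∧ |∫ x, x ∂D| ≤ lam ∧ variance id D ≤ σ ^ 2}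

/-! ### First stage: Gray-code localization -/

/-- The `k`-th Gray function (on all of `ℝ`, since rescaled samples may leave `[0, 1]`). -/
def grayFun (k : ℕ) (x : ℝ) : Bool :=
  decide (⌊2 ^ k * x⌋ % 4 = 1 ∨ ⌊2 ^ k * x⌋ % 4 = 2)

/-- The points of `[0, 1]` with the given Gray bits. -/
def grayDecode (K : ℕ) (z : Fin K → Bool) : Set ℝ :=
  {x | x ∈ Set.Icc (0 : ℝ) 1 ∧ ∀ k : Fin K, grayFun (k + 1) x = z k}

/-- The number of Gray bits, `⌊log₂ (2 lam / σ) - 3⌋`, or `0` if this is negative. -/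
def numGroups (lam σ : ℝ) : ℕ := ⌊Real.logb 2 (2 * lam / σ) - 3⌋₊

/-- The number of samples used for each Gray bit. -/
def groupSize (lam σ δ : ℝ) : ℕ := ⌈8 * Real.log (3 * numGroups lam σ / δ)⌉₊

/-- Majority vote, ties giving `1`. -/
def majority {J : ℕ} (z : Fin J → Bool) : Bool :=
  decide ((J : ℝ) / 2 ≤ ((Finset.univ.filter fun j => z j = true).card : ℝ))

/-- Left endpoint `L'` of the widened decoded interval, in the scale `[0, 1]`. -/
def widenedLeft (K : ℕ) (z : Fin K → Bool) : ℝ :=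
  max 0 (sInf (grayDecode K z) - 1 / 2 ^ (K + 2))

/-- Right endpoint `U'` of the widened decoded interval, in the scale `[0, 1]`. -/
def widenedRight (K : ℕ) (z : Fin K → Bool) : ℝ :=
  min 1 (sInf (grayDecode K z) + 1 / 2 ^ K + 1 / 2 ^ (K + 2))

/-- The midpoint of the localized interval `[2 lam L' - lam, 2 lam U' - lam]`. -/
def locCenter (lam : ℝ) (K : ℕ) (z : Fin K → Bool) : ℝ :=
  ((2 * lam * widenedLeft K z - lam) + (2 * lam * widenedRight K z - lam)) / 2

/-! ### Second stage: refinement by randomized interval queries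

The refinement stage works at a scale `s` such that the localized interval has length at most `6 s`
and the variance is at most `s²`.  The Gray-code interval has length at most `24 σ`, so `s = 4 σ`. -/

/-- The numbers `m_i`: `0` for `i = 0`, `2 ^ i` for `1 ≤ i ≤ 4`, and `2 (m_{i-1} - 3)` for `i ≥ 5`. -/
def mSeq : ℕ → ℝ
  | 0 => 0
  | i + 1 => if i + 1 ≤ 4 then 2 ^ (i + 1) else 2 * (mSeq i - 3)

/-- Left endpoint of the region `R_i` (`pos = true`) or `R_{-i}` (`pos = false`), where
`R_i = [m_{i-1} s, m_i s)` and `R_{-i} = [-m_i s, -m_{i-1} s)` relative to the center. -/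
def regionLeft (s : ℝ) (i : ℕ) (pos : Bool) : ℝ :=
  if pos then mSeq (i - 1) * s else -(mSeq i * s)

/-- Right endpoint of the region `R_i` (`pos = true`) or `R_{-i}` (`pos = false`). -/
def regionRight (s : ℝ) (i : ℕ) (pos : Bool) : ℝ :=
  if pos then mSeq i * s else -(mSeq (i - 1) * s)

/-- The regions `R_i` with `|i| > iMax` are ignored. -/
def iMax (s ε : ℝ) : ℕ := sInf {i : ℕ | 5 ≤ i ∧ 1 / 2 ^ i ≤ 5 * ε / (128 * s)}

/-- The accuracy to which the probabilities attached to `R_i` and `R_{-i}` are estimated. -/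
def regionAcc (s ε : ℝ) (i : ℕ) : ℝ := ε / (4 * iMax s ε * (mSeq (i - 1) * s + mSeq i * s))

/-- The failure probability allowed for each estimated probability. -/
def regionConf (s ε δ : ℝ) : ℝ := δ / (8 * iMax s ε)

/-- The number of samples used for each of the two probabilities attached to `R_i` or `R_{-i}`. -/
def regionSize (s ε δ : ℝ) (i : ℕ) : ℕ :=
  if i ≤ 4 then
    ⌈1 / (2 * regionAcc s ε i ^ 2) * Real.log (2 / regionConf s ε δ)⌉₊
  else
    ⌈(8 / mSeq i ^ 2 * (1 / regionAcc s ε i ^ 2) + 2 / 3 * (1 / regionAcc s ε i)) *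
      Real.log (2 / regionConf s ε δ)⌉₊

/-- The query `X ∈ [a, T]` (`left = true`) or `X ∈ [T, b)` (`left = false`), where
`T = a + (b - a) u`. -/
def thresholdQuery (a b u : ℝ) (left : Bool) (x : ℝ) : Bool :=
  if left then decide (a ≤ x ∧ x ≤ a + (b - a) * u) else decide (a + (b - a) * u ≤ x ∧ x < b)

/-! ### The two-stage estimator -/

/-- The samples of the first stage: group `k`, position `j` in the group. -/
abbrev LocIndex (lam σ δ : ℝ) : Type := Fin (numGroups lam σ) × Fin (groupSize lam σ δ)

/-- The samples of the second stage: `⟨i, pos, left, j⟩` is the `j`-th sample used to estimate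
`P(X - c ∈ [a, T])` (`left = true`) or `P(X - c ∈ [T, b))` (`left = false`) for the region `[a, b)`
of index `i + 1` (`pos = true`) or `-(i + 1)` (`pos = false`); `c` is the center. -/
abbrev RefIndex (s ε δ : ℝ) : Type :=
  (i : Fin (iMax s ε)) × Bool × Bool × Fin (regionSize s ε δ (i + 1))

/-- All samples of the two-stage estimator. -/
abbrev SampleIndex (lam σ ε δ : ℝ) : Type := LocIndex lam σ δ ⊕ RefIndex (4 * σ) ε δ

/-- The center computed from the answers of the first stage. -/
def centerOf (lam σ ε δ : ℝ) (y : SampleIndex lam σ ε δ → Bool) : ℝ :=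
  locCenter lam (numGroups lam σ) fun k => majority fun j => y (Sum.inl (k, j))

/-- Empirical frequency of the answer `1`. -/
def empFreq {n : ℕ} (z : Fin n → Bool) : ℝ :=
  ((Finset.univ.filter fun j => z j = true).card : ℝ) / n

/-- The estimate: the center plus the sum of `a * p̂_a + b * p̂_b` over the regions `[a, b)`. -/
def twoStageEstimate (lam σ ε δ : ℝ) (y : SampleIndex lam σ ε δ → Bool) : ℝ :=
  centerOf lam σ ε δ y +
    ∑ i : Fin (iMax (4 * σ) ε), ∑ pos : Bool,
      (regionLeft (4 * σ) (i + 1) pos * empFreq (fun j => y (Sum.inr ⟨i, pos, true, j⟩)) +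
       regionRight (4 * σ) (i + 1) pos * empFreq (fun j => y (Sum.inr ⟨i, pos, false, j⟩)))

/-- The quantizers.  In the first stage, the sample `x` of group `k` is mapped to the `k`-th Gray
bit of `(x + lam) / (2 lam)`.  In the second stage, randomized interval queries are applied to
`x - c`; the `u t` are independent and uniform on `[0, 1]`. -/
def twoStageQuery (lam σ ε δ : ℝ) :
    SampleIndex lam σ ε δ → (RefIndex (4 * σ) ε δ → ℝ) → (SampleIndex lam σ ε δ → Bool) →
      ℝ → Bool
  | Sum.inl (k, _), _, _, x => grayFun (k + 1) ((x + lam) / (2 * lam))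
  | Sum.inr ⟨i, pos, left, j⟩, u, y, x =>
      thresholdQuery (regionLeft (4 * σ) (i + 1) pos) (regionRight (4 * σ) (i + 1) pos)
        (u ⟨i, pos, left, j⟩) left (x - centerOf lam σ ε δ y)

lemma measurable_grayFun (k : ℕ) : Measurable (grayFun k) := by
  have h : Measurable fun x : ℝ => ⌊(2 : ℝ) ^ k * x⌋ :=
    Int.measurable_floor.comp (measurable_const.mul measurable_id)
  exact (measurable_of_countable
    (fun n : ℤ => decide (n % 4 = 1 ∨ n % 4 = 2))).comp h

lemma measurable_thresholdQuery (a b : ℝ) (left : Bool) :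
    Measurable fun p : ℝ × ℝ => thresholdQuery a b p.1 left p.2 := by
  cases left
  · refine measurable_to_bool ?_
    have : (fun p : ℝ × ℝ => thresholdQuery a b p.1 false p.2) ⁻¹' {true} =
        {p | a + (b - a) * p.1 ≤ p.2} ∩ {p | p.2 < b} := by
      ext p; simp [thresholdQuery]
    rw [this]
    exact (measurableSet_le (by fun_prop) (by fun_prop)).inter
      (measurableSet_lt (by fun_prop) (by fun_prop))
  · refine measurable_to_bool ?_
    have : (fun p : ℝ × ℝ => thresholdQuery a b p.1 true p.2) ⁻¹' {true} =
        {p | a ≤ p.2} ∩ {p | p.2 ≤ a + (b - a) * p.1} := by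
      ext p; simp [thresholdQuery]
    rw [this]
    exact (measurableSet_le (by fun_prop) (by fun_prop)).inter
      (measurableSet_le (by fun_prop) (by fun_prop))

/-- The two-stage estimator: Gray-code localization (round `0`), then refinement by randomized
interval queries (round `1`). -/
def twoStageEstimator (lam σ ε δ : ℝ) : OneBitEstimator (SampleIndex lam σ ε δ) where
  Ω := RefIndex (4 * σ) ε δ → ℝ
  mΩ := inferInstance
  law := Measure.pi fun _ => volume.restrict (Set.Icc (0 : ℝ) 1)
  isProb := by
    have : IsProbabilityMeasure (volume.restrict (Set.Icc (0 : ℝ) 1)) := ⟨by simp⟩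
    infer_instance
  round := Sum.elim (fun _ => 0) (fun _ => 1)
  query := twoStageQuery lam σ ε δ
  causal := by
    rintro (⟨k, j⟩ | ⟨i, pos, left, j⟩) u y y' h
    · rfl
    · have hc : centerOf lam σ ε δ y = centerOf lam σ ε δ y' := by
        unfold centerOf
        congr 1
        funext k
        congr 1
        funext j
        exact h (Sum.inl (k, j)) (by simp)
      funext x
      simp only [twoStageQuery, hc]
  measurable_query := by
    rintro (⟨k, j⟩ | ⟨i, pos, left, j⟩) y
    · exact (measurable_grayFun _).comp (by fun_prop)
    · have h : Measurable fun p : (RefIndex (4 * σ) ε δ → ℝ) × ℝ =>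
          (p.1 ⟨i, pos, left, j⟩, p.2 - centerOf lam σ ε δ y) :=
        ((measurable_pi_apply _).comp measurable_fst).prodMk
          (measurable_snd.sub measurable_const)
      exact (measurable_thresholdQuery _ _ left).comp h
  estimate := fun _ y => twoStageEstimate lam σ ε δ y
  measurable_estimate := fun _ => measurable_const

end

/-!
The estimator is analysed stage by stage.

*Localization.* The bit `g_k` switches exactly at the odd multiples of `2 ^ (-k)`
(`grayFun_eq_decide_odd`).  For `k ≤ K` these are distinct multiples of `2 ^ (-K)`, so at most one
level has a switch within `2 ^ (-(K + 2))` of the rescaled mean.  At every other level Chebyshev's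
inequality bounds by `1 / 4` the probability that the bit of a sample differs from the bit of the
mean, because the rescaled standard deviation is at most `2 ^ (-(K + 3))`, and the majority of the
bits is right up to probability `δ / (3 K)`.  At the exceptional level both values of the bit are
harmless: by the Gray property they decode to the two cells adjacent to the switch, and the widened
interval contains the mean in both cases (`exists_cell_of_correct_far_bits`).  Hence the center `c`
is within `12 σ = 3 s` of the mean up to probability `δ / 3`.

*Refinement.* With `T` uniform on `(a, b)`, a value `y ∈ [a, b)` is answered `1` with probability
`(b - y) / (b - a)` for the query `[a, T]` and `(y - a) / (b - a)` for `[T, b)`, so that the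
combination with weights `a` and `b` has expectation `y` (`endpoint_weighted_measureReal_eq`).
Summed over the regions this gives the mean of `X - c` truncated at `m_i s`, `i = i_max`, and the
variance bound makes the truncation error at most `ε / 2` (`abs_truncation_error_le`).  The
frequencies deviate from their expectations by at most `ε_i`, up to a total probability of `δ / 2`:
by Hoeffding's inequality for `i ≤ 4`, and for `i ≥ 5` by Bernstein's inequality, since the region
`R_i` then has probability at most `4 / m_i ^ 2`.  The `ε_i` are chosen such that these deviations
contribute at most `ε / 2`.

*Combination.* The center depends on the samples of the first stage only, and takes finitely many
values; so the failure probabilities of the second stage for the good values of the center are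
averaged, and both stages fail with probability at most `δ / 3 + δ / 2`
(`measureReal_twoStage_failure_le`).

*Sample size.* For `i ≥ 5` the factor `1 / m_i ^ 2` in the first term of `n_i` cancels the width of
the region in `1 / ε_i`, and in the second term `m_i ≤ 2 ^ i_max = O(σ / ε)`.  Thus each `n_i` is
`O(i_max ^ 2 (σ / ε) ^ 2)` up to the logarithm (`regionSize_le`), and `i_max` is
`O(1 + log (σ / ε))`.
-/

/-! ### The Gray code -/

/-- The bit `grayFun k` is the parity of the number of odd multiples of `2 ^ (-k)` passed so far, so
it switches exactly at these points. -/
lemma grayFun_eq_decide_odd (k : ℕ) (x : ℝ) :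
    grayFun k x = decide (Odd ⌊(2 ^ k * x + 1) / 2⌋) := by
  have h : ⌊(2 ^ k * x + 1) / 2⌋ = (⌊2 ^ k * x⌋ + 1) / 2 := by
    set n := ⌊2 ^ k * x⌋ with hn
    have h1 : (n : ℝ) ≤ 2 ^ k * x := Int.floor_le _
    have h2 : 2 ^ k * x < n + 1 := Int.lt_floor_add_one _
    have h3 : 2 * ((n + 1) / 2) ≤ n + 1 := by omega
    have h4 : n + 2 ≤ 2 * ((n + 1) / 2) + 2 := by omega
    have h3' : (2 : ℝ) * ((n + 1) / 2 : ℤ) ≤ n + 1 := by exact_mod_cast h3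
    have h4' : (n : ℝ) + 2 ≤ 2 * ((n + 1) / 2 : ℤ) + 2 := by exact_mod_cast h4
    rw [Int.floor_eq_iff]
    constructor <;> linarith
  rw [h, grayFun]
  congr 1
  rw [Int.odd_iff, eq_iff_iff]
  omega

/-- The bit `grayFun k` is constant between two switches. -/
lemma grayFun_eq_of_no_switch {k : ℕ} {x y : ℝ} (hxy : x ≤ y)
    (h : ∀ t : ℤ, 2 ^ k * x < 2 * t - 1 → 2 ^ k * y < 2 * t - 1) : grayFun k x = grayFun k y := by
  have hk : (0 : ℝ) < 2 ^ k := by positivity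
  have : ⌊(2 ^ k * x + 1) / 2⌋ = ⌊(2 ^ k * y + 1) / 2⌋ := by
    apply le_antisymm (Int.floor_mono (by gcongr))
    by_contra! hlt
    have h1 : (2 ^ k * x + 1) / 2 < ⌊(2 ^ k * y + 1) / 2⌋ := Int.floor_lt.1 hlt
    have h2 := h ⌊(2 ^ k * y + 1) / 2⌋ (by linarith)
    have h3 := Int.floor_le ((2 ^ k * y + 1) / 2)
    linarith
  rw [grayFun_eq_decide_odd, grayFun_eq_decide_odd, this]

lemma grayFun_eq_of_abs_sub_lt {k : ℕ} {x m r : ℝ}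
    (h : ∀ t : ℤ, r ≤ |m - (2 * t - 1) / 2 ^ k|) (hx : |x - m| < r) :
    grayFun k x = grayFun k m := by
  have hk : (0 : ℝ) < 2 ^ k := by positivity
  rw [abs_lt] at hx
  rcases le_total x m with hxm | hxm
  · refine grayFun_eq_of_no_switch hxm fun t ht => ?_
    by_contra! hc
    have h1 : x < (2 * t - 1) / 2 ^ k := by rw [lt_div_iff₀ hk]; linarith
    have h2 : (2 * t - 1) / 2 ^ k ≤ m := by rw [div_le_iff₀ hk]; linarith
    have h3 := h t
    rw [abs_of_nonneg (by linarith)] at h3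
    linarith
  · refine (grayFun_eq_of_no_switch hxm fun t ht => ?_).symm
    by_contra! hc
    have h1 : m < (2 * t - 1) / 2 ^ k := by rw [lt_div_iff₀ hk]; linarith
    have h2 : (2 * t - 1) / 2 ^ k ≤ x := by rw [div_le_iff₀ hk]; linarith
    have h3 := h t
    rw [abs_of_neg (by linarith)] at h3
    linarith

/-- In the scale in which the finest cells are the unit intervals between integers, the switches of
level `k + 1` are the odd multiples of `2 ^ (K - 1 - k)`. -/
lemma grayFun_eq_of_no_scaled_switch {K k : ℕ} (hk : k < K) {x y : ℝ} (hxy : x ≤ y)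
    (h : ∀ t : ℤ, 2 ^ K * x < ((2 * t - 1) * 2 ^ (K - 1 - k) : ℤ) →
      2 ^ K * y < ((2 * t - 1) * 2 ^ (K - 1 - k) : ℤ)) :
    grayFun (k + 1) x = grayFun (k + 1) y := by
  have hp : (0 : ℝ) < 2 ^ (K - 1 - k) := by positivity
  have hK : (2 : ℝ) ^ K = 2 ^ (k + 1) * 2 ^ (K - 1 - k) := by
    rw [← pow_add]; congr 1; omega
  refine grayFun_eq_of_no_switch hxy fun t ht => ?_
  have h1 := h t (by push_cast; rw [hK]; nlinarith)
  push_cast at h1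
  rw [hK] at h1
  nlinarith

/-- The Gray bits of levels `1, …, K` determine the dyadic cell of length `2 ^ (-K)`. -/
lemma floor_eq_of_grayFun_eq {x y : ℝ} (hx : x ∈ Set.Ico (0 : ℝ) 1) (hy : y ∈ Set.Ico (0 : ℝ) 1) :
    ∀ K : ℕ, (∀ k < K, grayFun (k + 1) x = grayFun (k + 1) y) → ⌊2 ^ K * x⌋ = ⌊2 ^ K * y⌋
  | 0, _ => by
    have h1 : ⌊x⌋ = 0 := Int.floor_eq_zero_iff.2 hx
    have h2 : ⌊y⌋ = 0 := Int.floor_eq_zero_iff.2 hy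
    simp [h1, h2]
  | K + 1, h => by
    have ih := floor_eq_of_grayFun_eq hx hy K fun k hk => h k (by omega)
    have hhalf : ∀ x : ℝ, ⌊2 ^ (K + 1) * x⌋ = 2 * ⌊2 ^ K * x⌋ ∨
        ⌊2 ^ (K + 1) * x⌋ = 2 * ⌊2 ^ K * x⌋ + 1 := by
      intro x
      have h1 := Int.floor_le (2 ^ K * x)
      have h2 := Int.lt_floor_add_one (2 ^ K * x)
      have h3 : 2 * ⌊2 ^ K * x⌋ ≤ ⌊2 ^ (K + 1) * x⌋ := by
        rw [Int.le_floor, pow_succ]; push_cast; linarith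
      have h4 : ⌊2 ^ (K + 1) * x⌋ < 2 * ⌊2 ^ K * x⌋ + 2 := by
        rw [Int.floor_lt, pow_succ]; push_cast; linarith
      omega
    have hg := h K (by omega)
    simp only [grayFun, decide_eq_decide] at hg
    rcases hhalf x with h1 | h1 <;> rcases hhalf y with h2 | h2 <;> rw [h1, h2] at hg <;>
      rw [h1, h2] <;> omega

/-- The infimum of the decoded set is the left endpoint of the decoded cell.  The point `1` lies in
no half-open cell of `[0, 1)`, but it never is the infimum. -/
lemma sInf_grayDecode {K : ℕ} {z : Fin K → Bool} {n : ℤ} (h0 : 0 ≤ n) (h1 : n < 2 ^ K)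
    (hz : ∀ k : Fin K, grayFun (k + 1) (n / 2 ^ K) = z k) :
    sInf (grayDecode K z) = n / 2 ^ K := by
  have hp : (0 : ℝ) < 2 ^ K := by positivity
  have h0' : (0 : ℝ) ≤ n := by exact_mod_cast h0
  have h1' : (n : ℝ) < 2 ^ K := by exact_mod_cast h1
  have hn : (n : ℝ) / 2 ^ K ∈ Set.Ico (0 : ℝ) 1 := ⟨by positivity, by rwa [div_lt_one hp]⟩
  refine IsLeast.csInf_eq ⟨⟨⟨hn.1, hn.2.le⟩, hz⟩, ?_⟩
  rintro x ⟨⟨hx0, hx1⟩, hx⟩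
  rcases hx1.eq_or_lt with rfl | hx1
  · exact hn.2.le
  have h := floor_eq_of_grayFun_eq hn ⟨hx0, hx1⟩ K fun k hk =>
    (hz ⟨k, hk⟩).trans (hx ⟨k, hk⟩).symm
  rw [mul_div_cancel₀ _ hp.ne', Int.floor_intCast] at h
  rw [div_le_iff₀ hp, mul_comm, h]
  exact Int.floor_le _

/-- Switches of different levels are different points. -/
lemma level_eq_of_switch_eq {K k l : ℕ} (hk : k < K) (hl : l < K) {s t : ℤ}
    (h : (2 * s - 1) * 2 ^ (K - 1 - k) = (2 * t - 1) * 2 ^ (K - 1 - l)) : k = l := by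
  have key : ∀ a b : ℕ, ∀ s t : ℤ, (2 * s - 1) * 2 ^ a = (2 * t - 1) * 2 ^ b → b ≤ a := by
    intro a b s t h
    by_contra! hlt
    obtain ⟨c, rfl⟩ := Nat.exists_eq_add_of_lt hlt
    have h2 : (2 * s - 1) * 2 ^ a = (2 * ((2 * t - 1) * 2 ^ c)) * 2 ^ a := by
      rw [h]; ring
    have := mul_right_cancel₀ (by positivity) h2
    omega
  have h1 := key _ _ _ _ h
  have h2 := key _ _ _ _ h.symm
  omega

lemma switch_ne_two_pow {K k : ℕ} (hk : k < K) (t : ℤ) :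
    (2 * t - 1) * 2 ^ (K - 1 - k) ≠ 2 ^ K := by
  intro h
  have h2 : (2 : ℤ) ^ K = (2 * 2 ^ k) * 2 ^ (K - 1 - k) := by
    rw [← pow_succ', ← pow_add]; congr 1; omega
  rw [h2] at h
  have := mul_right_cancel₀ (by positivity) h
  omega

/-- At most one level has a switch near `m`, and flipping the bit of that level moves the decoded
cell to the other side of the switch.  So wrong bits at levels with a switch near `m` do not matter:
the decoded cell, widened by a quarter of its length on both sides, contains `m`. -/
lemma exists_cell_of_correct_far_bits {K : ℕ} {z : Fin K → Bool} {m : ℝ}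
    (hm : m ∈ Set.Icc (0 : ℝ) 1)
    (hz : ∀ k : Fin K, (∀ t : ℤ, 1 / 2 ^ (K + 2) ≤ |m - (2 * t - 1) / 2 ^ ((k : ℕ) + 1)|) →
      z k = grayFun (k + 1) m) :
    ∃ n : ℤ, 0 ≤ n ∧ n < 2 ^ K ∧ (∀ k : Fin K, grayFun (k + 1) (n / 2 ^ K) = z k) ∧
      (n : ℝ) - 1 / 4 ≤ 2 ^ K * m ∧ 2 ^ K * m ≤ n + 1 + 1 / 4 := by
  have hp : (0 : ℝ) < 2 ^ K := by positivity
  have hscale : ∀ (k : Fin K) (t : ℤ), 2 ^ K * |m - (2 * t - 1) / 2 ^ ((k : ℕ) + 1)| =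
      |2 ^ K * m - ((2 * t - 1) * 2 ^ (K - 1 - k) : ℤ)| := by
    intro k t
    have hK : (2 : ℝ) ^ K = 2 ^ ((k : ℕ) + 1) * 2 ^ (K - 1 - k) := by
      rw [← pow_add]; congr 1; omega
    rw [← abs_of_pos hp, ← abs_mul, abs_of_pos hp, mul_sub]
    congr 2
    push_cast
    rw [hK]
    field_simp
  have hquarter : (2 : ℝ) ^ K * (1 / 2 ^ (K + 2)) = 1 / 4 := by
    rw [pow_add]; field_simp; norm_num
  have hy0 : 0 ≤ 2 ^ K * m := mul_nonneg hp.le hm.1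
  have hy1 : 2 ^ K * m ≤ 2 ^ K := mul_le_of_le_one_right hp.le hm.2
  by_cases hnear : ∃ (k : Fin K) (t : ℤ),
      |m - (2 * t - 1) / 2 ^ ((k : ℕ) + 1)| < 1 / 2 ^ (K + 2)
  · obtain ⟨k₀, t₀, h₀⟩ := hnear
    obtain ⟨r, hr⟩ : ∃ r : ℤ, r = (2 * t₀ - 1) * 2 ^ (K - 1 - k₀) := ⟨_, rfl⟩
    have hclose : |2 ^ K * m - r| < 1 / 4 := by
      rw [hr, ← hscale, ← hquarter]; gcongr
    rw [abs_lt] at hclose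
    have hr0 : 0 < r := by
      have h1 : (-1 : ℝ) < r := by linarith
      have h2 : -1 < r := by exact_mod_cast h1
      have h3 : r ≠ 0 := by
        rw [hr]; exact mul_ne_zero (by omega) (by positivity)
      omega
    have hr1 : r < 2 ^ K := by
      have h1 : (r : ℝ) < 2 ^ K + 1 := by linarith
      have h2 : r < 2 ^ K + 1 := by exact_mod_cast h1
      have h3 : r ≠ 2 ^ K := by rw [hr]; exact switch_ne_two_pow k₀.2 t₀
      omega
    -- the only switch strictly between the integers `r - 1` and `r + 1` is `r`, of level `k₀ + 1`
    have hconst : ∀ k : Fin K, k ≠ k₀ → ∀ x : ℝ, (r : ℝ) - 1 ≤ 2 ^ K * x → 2 ^ K * x < r + 1 →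
        grayFun (k + 1) ((r - 1 : ℤ) / 2 ^ K) = grayFun (k + 1) x := by
      intro k hk x hx0 hx1
      refine grayFun_eq_of_no_scaled_switch k.2
        (by rw [div_le_iff₀ hp]; push_cast; linarith) fun t ht => ?_
      rw [mul_div_cancel₀ _ hp.ne'] at ht
      by_contra! hc
      have h1 : r - 1 < (2 * t - 1) * 2 ^ (K - 1 - (k : ℕ)) := by exact_mod_cast ht
      have h2 : (((2 * t - 1) * 2 ^ (K - 1 - (k : ℕ)) : ℤ) : ℝ) < (r + 1 : ℤ) := by
        push_cast at hc ⊢; linarith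
      have h3 : (2 * t - 1) * 2 ^ (K - 1 - (k : ℕ)) < r + 1 := by exact_mod_cast h2
      have h4 : (2 * t - 1) * 2 ^ (K - 1 - (k : ℕ)) = (2 * t₀ - 1) * 2 ^ (K - 1 - (k₀ : ℕ)) := by
        omega
      exact hk (Fin.ext (level_eq_of_switch_eq k.2 k₀.2 h4))
    have hbits : ∀ k : Fin K, k ≠ k₀ → z k = grayFun (k + 1) m := by
      intro k hk
      refine hz k fun t => ?_
      by_contra! hc
      have h1 : |2 ^ K * m - ((2 * t - 1) * 2 ^ (K - 1 - (k : ℕ)) : ℤ)| < 1 / 4 := by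
        rw [← hscale, ← hquarter]; gcongr
      rw [abs_lt] at h1
      obtain ⟨q, hq⟩ : ∃ q : ℤ, q = (2 * t - 1) * 2 ^ (K - 1 - (k : ℕ)) := ⟨_, rfl⟩
      rw [← hq] at h1
      have h2 : ((q - 1 : ℤ) : ℝ) < r := by push_cast; linarith
      have h3 : ((r - 1 : ℤ) : ℝ) < q := by push_cast; linarith
      have h2' : q - 1 < r := by exact_mod_cast h2
      have h3' : r - 1 < q := by exact_mod_cast h3
      have h4 : q = r := by omega
      rw [hq, hr] at h4
      exact hk (Fin.ext (level_eq_of_switch_eq k.2 k₀.2 h4))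
    have hdiff : grayFun (k₀ + 1) ((r - 1 : ℤ) / 2 ^ K) ≠ grayFun (k₀ + 1) ((r : ℤ) / 2 ^ K) := by
      have hpk : (1 : ℝ) ≤ 2 ^ (K - 1 - (k₀ : ℕ)) := one_le_pow₀ (by norm_num)
      have hK : (2 : ℝ) ^ K = 2 ^ ((k₀ : ℕ) + 1) * 2 ^ (K - 1 - (k₀ : ℕ)) := by
        rw [← pow_add]; congr 1; omega
      have e1 : (2 : ℝ) ^ ((k₀ : ℕ) + 1) * ((r : ℤ) / 2 ^ K) = 2 * t₀ - 1 := by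
        rw [hr, hK]; push_cast; field_simp
      have e2 : (2 : ℝ) ^ ((k₀ : ℕ) + 1) * ((r - 1 : ℤ) / 2 ^ K) =
          2 * t₀ - 1 - 1 / 2 ^ (K - 1 - (k₀ : ℕ)) := by
        rw [hr, hK]; push_cast; field_simp
      have hinv0 : 0 < 1 / (2 : ℝ) ^ (K - 1 - (k₀ : ℕ)) := by positivity
      have hinv1 : 1 / (2 : ℝ) ^ (K - 1 - (k₀ : ℕ)) ≤ 1 := by
        rw [div_le_one (by positivity)]; exact hpk
      have f1 : ⌊((2 : ℝ) ^ ((k₀ : ℕ) + 1) * ((r : ℤ) / 2 ^ K) + 1) / 2⌋ = t₀ := by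
        rw [e1, Int.floor_eq_iff]; constructor <;> linarith
      have f2 : ⌊((2 : ℝ) ^ ((k₀ : ℕ) + 1) * ((r - 1 : ℤ) / 2 ^ K) + 1) / 2⌋ = t₀ - 1 := by
        rw [e2, Int.floor_eq_iff]; push_cast; constructor <;> linarith
      rw [grayFun_eq_decide_odd, grayFun_eq_decide_odd, f1, f2]
      simp only [ne_eq, decide_eq_decide, Int.odd_iff]
      omega
    by_cases hlast : grayFun (k₀ + 1) ((r : ℤ) / 2 ^ K) = z k₀
    · refine ⟨r, hr0.le, hr1, fun k => ?_, by linarith, by linarith⟩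
      by_cases hk : k = k₀
      · rw [hk, hlast]
      · rw [hbits k hk, ← hconst k hk m (by linarith) (by linarith)]
        exact (hconst k hk _ (by rw [mul_div_cancel₀ _ hp.ne']; linarith)
          (by rw [mul_div_cancel₀ _ hp.ne']; linarith)).symm
    · refine ⟨r - 1, by omega, by omega, fun k => ?_, by push_cast; linarith,
        by push_cast; linarith⟩
      by_cases hk : k = k₀
      · rw [hk]
        cases h1 : grayFun (k₀ + 1) ((r - 1 : ℤ) / 2 ^ K) <;>
          cases h2 : grayFun (k₀ + 1) ((r : ℤ) / 2 ^ K) <;>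
          cases h3 : z k₀ <;> simp_all
      · rw [hbits k hk]
        exact hconst k hk m (by linarith) (by linarith)
  · push Not at hnear
    have hbits : ∀ k : Fin K, z k = grayFun (k + 1) m := fun k => hz k (hnear k)
    rcases hm.2.eq_or_lt with rfl | hm1
    · refine ⟨2 ^ K - 1, ?_, by omega, fun k => ?_, by push_cast; linarith,
        by push_cast; linarith⟩
      · have : (0 : ℤ) < 2 ^ K := by positivity
        omega
      · rw [hbits k]
        refine grayFun_eq_of_no_scaled_switch k.2 ?_ fun t ht => ?_
        · rw [div_le_one hp]; push_cast; linarith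
        · rw [mul_div_cancel₀ _ hp.ne'] at ht
          have h1 : (2 : ℤ) ^ K - 1 < (2 * t - 1) * 2 ^ (K - 1 - (k : ℕ)) := by exact_mod_cast ht
          have h2 := switch_ne_two_pow k.2 t
          have h3 : (2 : ℤ) ^ K < (2 * t - 1) * 2 ^ (K - 1 - (k : ℕ)) := by omega
          rw [mul_one]
          exact_mod_cast h3
    · have hf0 := Int.floor_le (2 ^ K * m)
      have hf1 := Int.lt_floor_add_one (2 ^ K * m)
      refine ⟨⌊2 ^ K * m⌋, Int.floor_nonneg.2 hy0, ?_, fun k => ?_, by linarith, by linarith⟩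
      · rw [Int.floor_lt]; push_cast
        exact mul_lt_of_lt_one_right hp hm1
      · rw [hbits k]
        refine grayFun_eq_of_no_scaled_switch k.2
          (by rw [div_le_iff₀ hp]; linarith) fun t ht => ?_
        rw [mul_div_cancel₀ _ hp.ne'] at ht
        exact Int.floor_lt.1 (by exact_mod_cast ht)

/-- If the bits are right at every level without a switch near `m`, the widened interval contains
`m`. -/
lemma mem_Icc_widened {K : ℕ} {z : Fin K → Bool} {m : ℝ} (hm : m ∈ Set.Icc (0 : ℝ) 1)
    (hz : ∀ k : Fin K, (∀ t : ℤ, 1 / 2 ^ (K + 2) ≤ |m - (2 * t - 1) / 2 ^ ((k : ℕ) + 1)|) →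
      z k = grayFun (k + 1) m) :
    m ∈ Set.Icc (widenedLeft K z) (widenedRight K z) := by
  obtain ⟨n, h0, h1, hn, hl, hr⟩ := exists_cell_of_correct_far_bits hm hz
  have hp : (0 : ℝ) < 2 ^ K := by positivity
  have e : (1 : ℝ) / 2 ^ (K + 2) = (1 / 4) / 2 ^ K := by rw [pow_add]; field_simp; norm_num
  rw [widenedLeft, widenedRight, sInf_grayDecode h0 h1 hn, e]
  refine ⟨max_le hm.1 ?_, le_min hm.2 ?_⟩
  · rw [← sub_div, div_le_iff₀ hp]; linarith
  · rw [← add_div, ← add_div, le_div_iff₀ hp]; linarith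

lemma widenedRight_sub_widenedLeft_le (K : ℕ) (z : Fin K → Bool) :
    widenedRight K z - widenedLeft K z ≤ 3 / 2 / 2 ^ K := by
  have e : (1 : ℝ) / 2 ^ (K + 2) = (1 / 4) / 2 ^ K := by rw [pow_add]; field_simp; norm_num
  have h1 := min_le_right 1 (sInf (grayDecode K z) + 1 / 2 ^ K + 1 / 2 ^ (K + 2))
  have h2 := le_max_right 0 (sInf (grayDecode K z) - 1 / 2 ^ (K + 2))
  have h3 : (3 / 2 : ℝ) / 2 ^ K = 1 / 2 ^ K + (1 / 4) / 2 ^ K + (1 / 4) / 2 ^ K := by ring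
  rw [widenedLeft, widenedRight, h3]
  rw [e] at h1 h2 ⊢
  linarith

/-- The number of Gray bits is large enough for the localized interval to have length `24 σ`. -/
lemma lam_div_two_pow_numGroups_le {lam σ : ℝ} (hσ : 0 < σ) (hlam : σ ≤ lam) :
    2 * lam ≤ 16 * σ * 2 ^ numGroups lam σ := by
  have h1 : Real.logb 2 (2 * lam / σ) - 3 < numGroups lam σ + 1 := Nat.lt_floor_add_one _
  have h2 : Real.logb 2 (2 * lam / σ) < ((numGroups lam σ + 4 : ℕ) : ℝ) := by
    push_cast; linarith
  rw [Real.logb_lt_iff_lt_rpow (by norm_num) (by have := hσ.trans_le hlam; positivity),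
    Real.rpow_natCast, div_lt_iff₀ hσ, pow_add] at h2
  linarith

/-- The number of Gray bits is small enough for the finest cell to have length at least `8 σ`. -/
lemma two_pow_numGroups_mul_le {lam σ : ℝ} (hσ : 0 < σ) (hlam : σ ≤ lam)
    (hK : numGroups lam σ ≠ 0) : 2 ^ numGroups lam σ * (8 * σ) ≤ 2 * lam := by
  have h0 : 0 ≤ Real.logb 2 (2 * lam / σ) - 3 := by
    by_contra! h
    exact hK (Nat.floor_of_nonpos h.le)
  have h1 : (numGroups lam σ : ℝ) ≤ Real.logb 2 (2 * lam / σ) - 3 := Nat.floor_le h0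
  have h2 : ((numGroups lam σ + 3 : ℕ) : ℝ) ≤ Real.logb 2 (2 * lam / σ) := by
    push_cast; linarith
  rw [Real.le_logb_iff_rpow_le (by norm_num) (by have := hσ.trans_le hlam; positivity),
    Real.rpow_natCast, le_div_iff₀ hσ, pow_add] at h2
  linarith

/-- If the bits are right at every level without a switch near the rescaled mean, the center is
within `12 σ` of the mean. -/
lemma abs_sub_locCenter_le {lam σ : ℝ} (hσ : 0 < σ) (hlam : σ ≤ lam) {m : ℝ} (hm : |m| ≤ lam)
    {z : Fin (numGroups lam σ) → Bool}
    (hz : ∀ k : Fin (numGroups lam σ), (∀ t : ℤ, 1 / 2 ^ (numGroups lam σ + 2) ≤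
      |(m + lam) / (2 * lam) - (2 * t - 1) / 2 ^ ((k : ℕ) + 1)|) →
      z k = grayFun (k + 1) ((m + lam) / (2 * lam))) :
    |m - locCenter lam (numGroups lam σ) z| ≤ 12 * σ := by
  have hlam0 : 0 < lam := hσ.trans_le hlam
  rw [abs_le] at hm
  have hmem : (m + lam) / (2 * lam) ∈ Set.Icc (0 : ℝ) 1 :=
    ⟨div_nonneg (by linarith) (by linarith), by rw [div_le_one (by linarith)]; linarith⟩
  obtain ⟨h1, h2⟩ := mem_Icc_widened hmem hz
  rw [le_div_iff₀ (by linarith)] at h1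
  rw [div_le_iff₀ (by linarith)] at h2
  have h3 := widenedRight_sub_widenedLeft_le _ z
  have h4 : 2 * lam * (3 / 2 / 2 ^ numGroups lam σ) ≤ 24 * σ := by
    have := lam_div_two_pow_numGroups_le hσ hlam
    rw [← mul_div_assoc, div_le_iff₀ (by positivity)]
    linarith
  have h5 := mul_le_mul_of_nonneg_left h3 (by linarith : 0 ≤ 2 * lam)
  rw [locCenter, abs_le]
  constructor <;> linarith

/-! ### Concentration of empirical frequencies -/

lemma exp_le_one_add_add_sq_div {t : ℝ} (h0 : 0 ≤ t) (h3 : t < 3) :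
    Real.exp t ≤ 1 + t + t ^ 2 / (2 * (1 - t / 3)) := by
  have hs : HasSum (fun n : ℕ => t ^ n / n.factorial) (Real.exp t) := by
    rw [Real.exp_eq_exp_ℝ]; exact NormedSpace.expSeries_div_hasSum_exp t
  have h2 := (hasSum_nat_add_iff' 2).2 hs
  have hg : HasSum (fun n : ℕ => t ^ 2 / 2 * (t / 3) ^ n) (t ^ 2 / 2 * (1 - t / 3)⁻¹) :=
    (hasSum_geometric_of_lt_one (by positivity) (by linarith)).mul_left _
  have hfac : ∀ n : ℕ, (2 * 3 ^ n : ℝ) ≤ (n + 2).factorial := by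
    intro n
    have := Nat.factorial_mul_pow_le_factorial (m := 2) (n := n)
    rw [add_comm n 2]
    exact_mod_cast this
  have hle := hasSum_le (fun n => by
    show t ^ (n + 2) / ((n + 2).factorial : ℝ) ≤ t ^ 2 / 2 * (t / 3) ^ n
    calc t ^ (n + 2) / ((n + 2).factorial : ℝ) ≤ t ^ (n + 2) / (2 * 3 ^ n) := by
          gcongr; exact hfac n
      _ = t ^ 2 / 2 * (t / 3) ^ n := by rw [div_pow, pow_add]; field_simp) h2 hg
  have h4 : (1 - t / 3) ≠ 0 := by linarith
  rw [show t ^ 2 / (2 * (1 - t / 3)) = t ^ 2 / 2 * (1 - t / 3)⁻¹ by field_simp]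
  simp [Finset.sum_range_succ] at hle
  linarith

lemma exp_neg_le_one_sub_add_sq_div {t : ℝ} (h0 : 0 ≤ t) :
    Real.exp (-t) ≤ 1 - t + t ^ 2 / 2 := by
  have h1 := Real.quadratic_le_exp_of_nonneg h0
  have h2 : 0 < 1 - t + t ^ 2 / 2 := by nlinarith [sq_nonneg (t - 1)]
  rw [Real.exp_neg, inv_le_comm₀ (Real.exp_pos t) h2]
  refine le_trans ?_ h1
  rw [inv_le_iff_one_le_mul₀ h2]
  nlinarith [sq_nonneg (t ^ 2)]

lemma integral_toNat {Ω : Type*} [MeasurableSpace Ω] {P : Measure Ω} {B : Ω → Bool}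
    (hB : Measurable B) :
    ∫ ω, ((B ω).toNat : ℝ) ∂P = P.real {ω | B ω = true} := by
  have hs : MeasurableSet {ω | B ω = true} := hB (measurableSet_singleton true)
  rw [← integral_indicator_one hs]
  refine integral_congr_ae (Filter.Eventually.of_forall fun ω => ?_)
  cases h : B ω <;> simp [Set.indicator, h]

section Bits

variable {Ω : Type*} [MeasurableSpace Ω] {P : Measure Ω} [IsProbabilityMeasure P]

lemma integrable_toNat {B : Ω → Bool} (hB : Measurable B) :
    Integrable (fun ω => ((B ω).toNat : ℝ)) P :=
  Integrable.of_mem_Icc 0 1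
    ((measurable_of_countable fun b : Bool => (b.toNat : ℝ)).comp hB).aemeasurable
    (Filter.Eventually.of_forall fun ω => by cases B ω <;> simp)

/-- The moment generating function of a centered Bernoulli variable. -/
lemma mgf_toNat_sub {B : Ω → Bool} (hB : Measurable B) (t : ℝ) :
    mgf (fun ω => ((B ω).toNat : ℝ) - P.real {ω | B ω = true}) P t =
      Real.exp (-(t * P.real {ω | B ω = true})) *
        (1 + P.real {ω | B ω = true} * (Real.exp t - 1)) := by
  set p := P.real {ω | B ω = true} with hp
  have h : ∀ ω, Real.exp (t * (((B ω).toNat : ℝ) - p)) =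
      Real.exp (-(t * p)) * (1 + (Real.exp t - 1) * ((B ω).toNat : ℝ)) := by
    intro ω
    cases B ω
    · simp
    · simp only [Bool.toNat_true, Nat.cast_one, mul_one, add_sub_cancel]
      rw [← Real.exp_add]; ring_nf
  rw [mgf]
  simp_rw [h]
  rw [integral_const_mul, integral_add (integrable_const _) ((integrable_toNat hB).const_mul _),
    integral_const_mul, integral_toNat hB, ← hp]
  simp [mul_comm]

/-- The bound on the moment generating function behind Hoeffding's inequality. -/
lemma mgf_toNat_sub_le_hoeffding {B : Ω → Bool} (hB : Measurable B) (t : ℝ) :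
    mgf (fun ω => ((B ω).toNat : ℝ) - P.real {ω | B ω = true}) P t ≤ Real.exp (t ^ 2 / 8) := by
  have h := (hasSubgaussianMGF_of_mem_Icc (μ := P) (a := 0) (b := 1)
    ((measurable_of_countable fun b : Bool => (b.toNat : ℝ)).comp hB).aemeasurable
    (Filter.Eventually.of_forall fun ω => by
      simp only [Function.comp]; cases B ω <;> simp)).mgf_le t
  simp only [Function.comp, integral_toNat hB] at h
  refine h.trans (Real.exp_le_exp.2 (le_of_eq ?_))
  simp
  ring

/-- The bound on the moment generating function behind Bernstein's inequality, for both tails. -/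
lemma mgf_toNat_sub_le_bernstein {B : Ω → Bool} (hB : Measurable B) {q t : ℝ}
    (hq : P.real {ω | B ω = true} ≤ q) (h0 : 0 ≤ t) (h3 : t < 3) :
    mgf (fun ω => ((B ω).toNat : ℝ) - P.real {ω | B ω = true}) P t ≤
        Real.exp (q * (t ^ 2 / (2 * (1 - t / 3)))) ∧
      mgf (fun ω => ((B ω).toNat : ℝ) - P.real {ω | B ω = true}) P (-t) ≤
        Real.exp (q * (t ^ 2 / (2 * (1 - t / 3)))) := by
  rw [mgf_toNat_sub hB, mgf_toNat_sub hB]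
  set p := P.real {ω | B ω = true} with hp
  have hp0 : 0 ≤ p := measureReal_nonneg
  have hden : 0 < 1 - t / 3 := by linarith
  have key : ∀ x : ℝ, Real.exp x - 1 - x ≤ t ^ 2 / (2 * (1 - t / 3)) →
      Real.exp (-(x * p)) * (1 + p * (Real.exp x - 1)) ≤
        Real.exp (q * (t ^ 2 / (2 * (1 - t / 3)))) := by
    intro x hx
    calc Real.exp (-(x * p)) * (1 + p * (Real.exp x - 1))
        ≤ Real.exp (-(x * p)) * Real.exp (p * (Real.exp x - 1)) := by
          gcongr
          linarith [Real.add_one_le_exp (p * (Real.exp x - 1))]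
      _ = Real.exp (p * (Real.exp x - 1 - x)) := by rw [← Real.exp_add]; ring_nf
      _ ≤ Real.exp (q * (t ^ 2 / (2 * (1 - t / 3)))) := by
          apply Real.exp_le_exp.2
          calc p * (Real.exp x - 1 - x) ≤ p * (t ^ 2 / (2 * (1 - t / 3))) := by gcongr
            _ ≤ q * (t ^ 2 / (2 * (1 - t / 3))) := by gcongr
  refine ⟨key t (by linarith [exp_le_one_add_add_sq_div h0 h3]), key (-t) ?_⟩
  have h1 := exp_neg_le_one_sub_add_sq_div h0
  have h2 : t ^ 2 / 2 ≤ t ^ 2 / (2 * (1 - t / 3)) := by gcongr; linarith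
  linarith

variable {n : ℕ} {B : Fin n → Ω → Bool} {p : ℝ}

lemma empFreq_eq_sum (z : Fin n → Bool) : empFreq z = (∑ j, ((z j).toNat : ℝ)) / n := by
  rw [empFreq, Finset.card_filter]
  push_cast
  congr 1
  refine Finset.sum_congr rfl fun j _ => ?_
  cases z j <;> simp

/-- Chernoff's bound for the mean of independent bits of bias `p`; the sign of `t` selects the
tail. -/
lemma measureReal_le_exp_of_mgf_le (hB : ∀ j, Measurable (B j)) (hind : iIndepFun B P)
    (hp : ∀ j, P.real {ω | B j ω = true} = p) {t ψ : ℝ}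
    (hψ : ∀ j, mgf (fun ω => ((B j ω).toNat : ℝ) - P.real {ω | B j ω = true}) P t ≤ Real.exp ψ)
    (x : ℝ) :
    P.real {ω | n * x ≤ t * ∑ j, (((B j ω).toNat : ℝ) - p)} ≤ Real.exp (n * (ψ - x)) := by
  have hm : ∀ j, Measurable fun ω => ((B j ω).toNat : ℝ) - p := fun j =>
    ((measurable_of_countable fun b : Bool => (b.toNat : ℝ)).comp (hB j)).sub_const p
  have hi : iIndepFun (fun j ω => ((B j ω).toNat : ℝ) - p) P :=
    hind.comp (fun _ b => ((b.toNat : ℝ) - p)) fun _ => measurable_of_countable _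
  have hint : Integrable (fun ω => Real.exp (1 * (t * ∑ j, (((B j ω).toNat : ℝ) - p)))) P := by
    refine Integrable.of_bound (C := Real.exp (|t| * ∑ j : Fin n, (1 + |p|))) ?_ ?_
    · have := Finset.measurable_sum (Finset.univ : Finset (Fin n)) fun j _ => hm j
      exact (by fun_prop : Measurable fun ω =>
        Real.exp (1 * (t * ∑ j, (((B j ω).toNat : ℝ) - p)))).aestronglyMeasurable
    · refine Filter.Eventually.of_forall fun ω => ?_
      rw [Real.norm_eq_abs, Real.abs_exp]
      apply Real.exp_le_exp.2
      rw [one_mul]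
      refine (le_abs_self _).trans ?_
      rw [abs_mul]
      gcongr
      refine (Finset.abs_sum_le_sum_abs _ _).trans (Finset.sum_le_sum fun j _ => ?_)
      refine (abs_sub _ _).trans ?_
      gcongr
      cases B j ω <;> simp
  have h := measure_ge_le_exp_mul_mgf (μ := P) (n * x) zero_le_one hint
  refine h.trans ?_
  have hmgf : mgf (fun ω => t * ∑ j, (((B j ω).toNat : ℝ) - p)) P 1 ≤ Real.exp (n * ψ) := by
    have h1 : mgf (∑ j, fun ω => ((B j ω).toNat : ℝ) - p) P t =
        ∏ j, mgf (fun ω => ((B j ω).toNat : ℝ) - p) P t := hi.mgf_sum hm Finset.univ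
    have h2 : (fun ω => t * ∑ j, (((B j ω).toNat : ℝ) - p)) =
        fun ω => t * (∑ j, fun ω => ((B j ω).toNat : ℝ) - p) ω := by
      ext ω; simp [Finset.sum_apply]
    rw [h2, mgf_const_mul, mul_one, h1]
    calc ∏ j, mgf (fun ω => ((B j ω).toNat : ℝ) - p) P t ≤ ∏ _j : Fin n, Real.exp ψ :=
          Finset.prod_le_prod (fun _ _ => mgf_nonneg) fun j _ => by
            have := hψ j
            rwa [hp j] at this
      _ = Real.exp (n * ψ) := by simp [Real.exp_nat_mul]
  calc Real.exp (-1 * (n * x)) * mgf (fun ω => t * ∑ j, (((B j ω).toNat : ℝ) - p)) P 1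
      ≤ Real.exp (-1 * (n * x)) * Real.exp (n * ψ) := by gcongr
    _ = Real.exp (n * (ψ - x)) := by rw [← Real.exp_add]; ring_nf

/-- Two-sided form of Chernoff's bound. -/
lemma measureReal_abs_empFreq_sub_le (hB : ∀ j, Measurable (B j)) (hind : iIndepFun B P)
    (hp : ∀ j, P.real {ω | B j ω = true} = p) {t ψ ε : ℝ} (ht : 0 ≤ t) (hn : 0 < n)
    (hψ : ∀ j, mgf (fun ω => ((B j ω).toNat : ℝ) - P.real {ω | B j ω = true}) P t ≤ Real.exp ψ)
    (hψ' : ∀ j,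
      mgf (fun ω => ((B j ω).toNat : ℝ) - P.real {ω | B j ω = true}) P (-t) ≤ Real.exp ψ) :
    P.real {ω | ε < |empFreq (fun j => B j ω) - p|} ≤ 2 * Real.exp (n * (ψ - t * ε)) := by
  have hn' : (0 : ℝ) < n := by exact_mod_cast hn
  have h1 := measureReal_le_exp_of_mgf_le hB hind hp hψ (t * ε)
  have h2 := measureReal_le_exp_of_mgf_le hB hind hp hψ' (t * ε)
  rw [two_mul]
  refine le_trans (le_trans (measureReal_mono ?_) (measureReal_union_le _ _)) (add_le_add h1 h2)
  intro ω hω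
  have hsum : ∑ j, (((B j ω).toNat : ℝ) - p) = n * (empFreq (fun j => B j ω) - p) := by
    rw [empFreq_eq_sum, Finset.sum_sub_distrib, mul_sub, mul_div_cancel₀ _ hn'.ne']
    simp
  simp only [Set.mem_union, Set.mem_ofPred_eq, hsum] at hω ⊢
  rcases lt_abs.1 hω with h | h
  · left
    calc n * (t * ε) = t * (n * ε) := by ring
      _ ≤ _ := by gcongr
  · right
    calc n * (t * ε) = t * (n * ε) := by ring
      _ ≤ t * (n * -(empFreq (fun j => B j ω) - p)) := by gcongr
      _ = _ := by ring

/-- Hoeffding's inequality, solved for the number of samples. -/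
lemma measureReal_abs_empFreq_sub_le_of_hoeffding (hB : ∀ j, Measurable (B j))
    (hind : iIndepFun B P) (hp : ∀ j, P.real {ω | B j ω = true} = p) {ε δ : ℝ} (hε : 0 < ε)
    (hδ : 0 < δ) (hδ2 : δ < 2) (hn : 1 / (2 * ε ^ 2) * Real.log (2 / δ) ≤ n) :
    P.real {ω | ε < |empFreq (fun j => B j ω) - p|} ≤ δ := by
  have hlog : 0 < Real.log (2 / δ) := Real.log_pos (by rwa [one_lt_div hδ])
  have hn0 : (0 : ℝ) < n := lt_of_lt_of_le (by positivity) hn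
  -- `t = 4 ε` minimizes `t ^ 2 / 8 - t * ε`
  have h := measureReal_abs_empFreq_sub_le hB hind hp (t := 4 * ε) (ε := ε)
    (ψ := (4 * ε) ^ 2 / 8) (by positivity) (by exact_mod_cast hn0)
    (fun j => mgf_toNat_sub_le_hoeffding (hB j) _)
    (fun j => by simpa using mgf_toNat_sub_le_hoeffding (P := P) (hB j) (-(4 * ε)))
  refine h.trans ?_
  rw [one_div, inv_mul_le_iff₀ (by positivity)] at hn
  have h1 : Real.exp (n * ((4 * ε) ^ 2 / 8 - 4 * ε * ε)) ≤ Real.exp (-Real.log (2 / δ)) :=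
    Real.exp_le_exp.2 (by nlinarith)
  rw [Real.exp_neg, Real.exp_log (by positivity), inv_div] at h1
  linarith

/-- Bernstein's inequality for bits of bias at most `q`, solved for the number of samples. -/
lemma measureReal_abs_empFreq_sub_le_of_bernstein (hB : ∀ j, Measurable (B j))
    (hind : iIndepFun B P) (hp : ∀ j, P.real {ω | B j ω = true} = p) {q ε δ : ℝ} (hε : 0 < ε)
    (hq : 0 < q) (hpq : p ≤ q) (hδ : 0 < δ) (hδ2 : δ < 2)
    (hn : (2 * q / ε ^ 2 + 2 / (3 * ε)) * Real.log (2 / δ) ≤ n) :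
    P.real {ω | ε < |empFreq (fun j => B j ω) - p|} ≤ δ := by
  have hlog : 0 < Real.log (2 / δ) := Real.log_pos (by rwa [one_lt_div hδ])
  have hn0 : (0 : ℝ) < n := lt_of_lt_of_le (by positivity) hn
  -- the customary choice of `t`, for which the exponent is `-ε ^ 2 / (2 (q + ε / 3))`
  obtain ⟨t, ht⟩ : ∃ t, t = ε / (q + ε / 3) := ⟨_, rfl⟩
  have ht0 : 0 < t := by rw [ht]; positivity
  have ht3 : t < 3 := by rw [ht, div_lt_iff₀ (by positivity)]; linarith
  have h := measureReal_abs_empFreq_sub_le hB hind hp (ε := ε) ht0.le (by exact_mod_cast hn0)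
    (fun j => (mgf_toNat_sub_le_bernstein (hB j) ((hp j).trans_le hpq) ht0.le ht3).1)
    (fun j => (mgf_toNat_sub_le_bernstein (hB j) ((hp j).trans_le hpq) ht0.le ht3).2)
  refine h.trans ?_
  have he : q * (t ^ 2 / (2 * (1 - t / 3))) - t * ε = -(ε ^ 2 / (2 * (q + ε / 3))) := by
    have h1 : 1 - t / 3 = q / (q + ε / 3) := by rw [ht]; field_simp; ring
    rw [h1, ht]; field_simp; ring
  have h2 : (2 * q / ε ^ 2 + 2 / (3 * ε)) * (ε ^ 2 / (2 * (q + ε / 3))) = 1 := by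
    field_simp
  have h3 : Real.log (2 / δ) ≤ n * (ε ^ 2 / (2 * (q + ε / 3))) := by
    calc Real.log (2 / δ) = (2 * q / ε ^ 2 + 2 / (3 * ε)) * (ε ^ 2 / (2 * (q + ε / 3))) *
          Real.log (2 / δ) := by rw [h2, one_mul]
      _ = (2 * q / ε ^ 2 + 2 / (3 * ε)) * Real.log (2 / δ) * (ε ^ 2 / (2 * (q + ε / 3))) := by ring
      _ ≤ _ := by gcongr
  have h1 : Real.exp (n * (q * (t ^ 2 / (2 * (1 - t / 3))) - t * ε)) ≤
      Real.exp (-Real.log (2 / δ)) := by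
    rw [he]; exact Real.exp_le_exp.2 (by linarith)
  rw [Real.exp_neg, Real.exp_log (by positivity), inv_div] at h1
  linarith

/-- The majority of independent bits, each of them wrong with probability at most `1 / 4`, is wrong
with probability at most `exp (-n / 8)`. -/
lemma measureReal_majority_ne_le (hB : ∀ j, Measurable (B j)) (hind : iIndepFun B P)
    (hp : ∀ j, P.real {ω | B j ω = true} = p) {g : Bool}
    (hg : ∀ j, P.real {ω | B j ω ≠ g} ≤ 1 / 4) :
    P.real {ω | majority (fun j => B j ω) ≠ g} ≤ Real.exp (-(n / 8)) := by
  rcases Nat.eq_zero_or_pos n with rfl | hn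
  · simp
  have hn' : (0 : ℝ) < n := by exact_mod_cast hn
  have hcard : ∀ ω, ((Finset.univ.filter fun j => B j ω = true).card : ℝ) =
      ∑ j, (((B j ω).toNat : ℝ) - p) + n * p := by
    intro ω
    rw [Finset.card_filter, Finset.sum_sub_distrib]
    simp only [Finset.sum_const, Finset.card_univ, Fintype.card_fin, nsmul_eq_mul, sub_add_cancel]
    push_cast
    refine Finset.sum_congr rfl fun j _ => ?_
    cases B j ω <;> simp
  -- the margin is `1 / 4`, and `t = 1` minimizes `t ^ 2 / 8 - t / 4`
  have hexp : Real.exp (n * (1 ^ 2 / 8 - 1 / 4)) = Real.exp (-((n : ℝ) / 8)) := by ring_nf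
  rw [← hexp]
  cases g
  · have hp4 : p ≤ 1 / 4 := by
      have := hg ⟨0, hn⟩
      simp only [ne_eq, Bool.not_eq_false, hp] at this
      exact this
    refine le_trans (measureReal_mono fun ω hω => ?_) (measureReal_le_exp_of_mgf_le hB hind hp
      (fun j => mgf_toNat_sub_le_hoeffding (hB j) 1) (1 / 4))
    simp only [majority, ne_eq, Set.mem_ofPred_eq, decide_eq_false_iff_not, not_not, hcard] at hω ⊢
    nlinarith
  · have hp4 : 3 / 4 ≤ p := by
      have h1 := hg ⟨0, hn⟩
      have hs : MeasurableSet {ω | B ⟨0, hn⟩ ω = true} := hB _ (measurableSet_singleton true)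
      have h2 : {ω | B ⟨0, hn⟩ ω ≠ true} = {ω | B ⟨0, hn⟩ ω = true}ᶜ := rfl
      rw [h2, probReal_compl_eq_one_sub hs, hp] at h1
      linarith
    have h := measureReal_le_exp_of_mgf_le hB hind hp (t := -1) (ψ := 1 ^ 2 / 8)
      (fun j => by simpa using mgf_toNat_sub_le_hoeffding (P := P) (hB j) (-1)) (1 / 4)
    refine le_trans (measureReal_mono fun ω hω => ?_) h
    simp only [majority, ne_eq, Set.mem_ofPred_eq, decide_eq_true_eq, not_le, hcard] at hω ⊢
    nlinarith

end Bits

/-! ### Randomized interval queries on one region -/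

/-- The probability that the randomized query of a region `[a, b)` answers `1` on the value `y`. -/
noncomputable def queryWeight (a b : ℝ) (left : Bool) : ℝ → ℝ :=
  (Set.Ico a b).indicator fun y => if left then (b - y) / (b - a) else (y - a) / (b - a)

lemma queryWeight_mem_Icc {a b : ℝ} (hab : a < b) (left : Bool) (y : ℝ) :
    0 ≤ queryWeight a b left y ∧
      queryWeight a b left y ≤ (Set.Ico a b).indicator (fun _ => 1) y := by
  rw [queryWeight]
  by_cases hy : y ∈ Set.Ico a b
  · have h1 : 0 < b - a := by linarith
    have h2 := hy.1
    have h3 := hy.2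
    rw [Set.indicator_of_mem hy, Set.indicator_of_mem hy]
    cases left <;> simp only [Bool.false_eq_true, if_true, if_false] <;>
      exact ⟨div_nonneg (by linarith) h1.le, by rw [div_le_one h1]; linarith⟩
  · simp [Set.indicator_of_notMem hy]

lemma measurable_queryWeight (a b : ℝ) (left : Bool) : Measurable (queryWeight a b left) := by
  refine Measurable.indicator ?_ measurableSet_Ico
  cases left <;> simp only [Bool.false_eq_true, if_true, if_false] <;> fun_prop

lemma volume_thresholdQuery {a b : ℝ} (hab : a < b) (left : Bool) (y : ℝ) :
    volume.restrict (Set.Icc (0 : ℝ) 1) {u | thresholdQuery a b u left y = true} =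
      ENNReal.ofReal (queryWeight a b left y) := by
  have hba : 0 < b - a := by linarith
  have hr : ∀ u, y ≤ a + (b - a) * u ↔ (y - a) / (b - a) ≤ u := fun u => by
    rw [div_le_iff₀ hba]; constructor <;> intro h <;> linarith
  have hr' : ∀ u, a + (b - a) * u ≤ y ↔ u ≤ (y - a) / (b - a) := fun u => by
    rw [le_div_iff₀ hba]; constructor <;> intro h <;> linarith
  rw [Measure.restrict_apply' measurableSet_Icc]
  have hone : 1 - (y - a) / (b - a) = (b - y) / (b - a) := by field_simp; ring
  cases left
  · have hset : {u | thresholdQuery a b u false y = true} ∩ Set.Icc (0 : ℝ) 1 =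
        if y < b then Set.Icc 0 ((y - a) / (b - a)) else ∅ := by
      ext u
      split_ifs with hy
      · have : (y - a) / (b - a) < 1 := by rw [div_lt_one hba]; linarith
        simp only [thresholdQuery, Bool.false_eq_true, if_false, decide_eq_true_eq, hr', hy,
          Set.mem_inter_iff, Set.mem_ofPred_eq, Set.mem_Icc, and_true]
        constructor
        · rintro ⟨h1, h2, h3⟩; exact ⟨h2, h1⟩
        · rintro ⟨h1, h2⟩; exact ⟨h2, h1, by linarith⟩
      · simp [thresholdQuery, hy]
    rw [hset, queryWeight]
    by_cases hy : y < b
    · rw [if_pos hy, Real.volume_Icc, sub_zero]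
      by_cases hya : a ≤ y
      · rw [Set.indicator_of_mem (Set.mem_Ico.2 ⟨hya, hy⟩)]; simp
      · rw [Set.indicator_of_notMem (fun h => hya h.1), ENNReal.ofReal_zero]
        exact ENNReal.ofReal_of_nonpos (div_nonpos_of_nonpos_of_nonneg (by linarith) hba.le)
    · rw [if_neg hy, Set.indicator_of_notMem (fun h => hy h.2)]; simp
  · have hset : {u | thresholdQuery a b u true y = true} ∩ Set.Icc (0 : ℝ) 1 =
        if a ≤ y then Set.Icc ((y - a) / (b - a)) 1 else ∅ := by
      ext u
      split_ifs with hy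
      · have : 0 ≤ (y - a) / (b - a) := div_nonneg (by linarith) hba.le
        simp only [thresholdQuery, if_true, decide_eq_true_eq, hr, hy,
          Set.mem_inter_iff, Set.mem_ofPred_eq, Set.mem_Icc, true_and]
        constructor
        · rintro ⟨h1, h2, h3⟩; exact ⟨h1, h3⟩
        · rintro ⟨h1, h2⟩; exact ⟨h1, by linarith, h2⟩
      · simp [thresholdQuery, hy]
    rw [hset, queryWeight]
    by_cases hya : a ≤ y
    · rw [if_pos hya, Real.volume_Icc, hone]
      by_cases hy : y < b
      · rw [Set.indicator_of_mem (Set.mem_Ico.2 ⟨hya, hy⟩)]; simp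
      · rw [Set.indicator_of_notMem (fun h => hy h.2), ENNReal.ofReal_zero]
        exact ENNReal.ofReal_of_nonpos (div_nonpos_of_nonpos_of_nonneg (by linarith) hba.le)
    · rw [if_neg hya, Set.indicator_of_notMem (fun h => hya h.1)]; simp

/-- The joint law of a sample and of the uniform variable that drives its threshold. -/
noncomputable abbrev querySpace (D : Measure ℝ) : Measure (ℝ × ℝ) :=
  (volume.restrict (Set.Icc (0 : ℝ) 1)).prod D

instance isProbabilityMeasure_unif : IsProbabilityMeasure (volume.restrict (Set.Icc (0 : ℝ) 1)) :=
  ⟨by simp⟩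

section Region

variable {D : Measure ℝ} [IsProbabilityMeasure D]

lemma measurable_thresholdQuery_sub (a b c : ℝ) (left : Bool) :
    Measurable fun p : ℝ × ℝ => thresholdQuery a b p.1 left (p.2 - c) :=
  (measurable_thresholdQuery a b left).comp
    (measurable_fst.prodMk (measurable_snd.sub measurable_const))

lemma integrable_queryWeight_sub {a b : ℝ} (hab : a < b) (c : ℝ) (left : Bool) :
    Integrable (fun x => queryWeight a b left (x - c)) D :=
  Integrable.of_mem_Icc 0 1
    ((measurable_queryWeight a b left).comp (measurable_id.sub_const c)).aemeasurable
    (Filter.Eventually.of_forall fun x =>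
      ⟨(queryWeight_mem_Icc hab left _).1, (queryWeight_mem_Icc hab left _).2.trans
        (Set.indicator_le_self' (by simp) _)⟩)

lemma measureReal_thresholdQuery {a b : ℝ} (hab : a < b) (c : ℝ) (left : Bool) :
    (querySpace D).real {p | thresholdQuery a b p.1 left (p.2 - c) = true} =
      ∫ x, queryWeight a b left (x - c) ∂D := by
  have hs : MeasurableSet {p : ℝ × ℝ | thresholdQuery a b p.1 left (p.2 - c) = true} :=
    measurable_thresholdQuery_sub a b c left (measurableSet_singleton true)
  rw [measureReal_def, Measure.prod_apply_symm hs, integral_eq_lintegral_of_nonneg_ae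
    (Filter.Eventually.of_forall fun x => (queryWeight_mem_Icc hab left _).1)
    (integrable_queryWeight_sub hab c left).aestronglyMeasurable]
  congr 1
  refine lintegral_congr fun x => ?_
  exact volume_thresholdQuery hab left (x - c)

lemma measureReal_thresholdQuery_le {a b : ℝ} (hab : a < b) (c : ℝ) (left : Bool) :
    (querySpace D).real {p | thresholdQuery a b p.1 left (p.2 - c) = true} ≤
      D.real {x | x - c ∈ Set.Ico a b} := by
  have hs : MeasurableSet {x | x - c ∈ Set.Ico a b} :=
    (measurable_id.sub_const c) measurableSet_Ico
  rw [measureReal_thresholdQuery hab, ← integral_indicator_one hs]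
  exact integral_mono (integrable_queryWeight_sub hab c left)
    ((integrable_const (1 : ℝ)).indicator hs) fun x => (queryWeight_mem_Icc hab left _).2

/-- The randomized thresholds make the endpoint-weighted answers unbiased: interpolating linearly
between `a` and `b` reproduces the identity on the region. -/
lemma endpoint_weighted_measureReal_eq {a b : ℝ} (hab : a < b) (c : ℝ) :
    a * (querySpace D).real {p | thresholdQuery a b p.1 true (p.2 - c) = true} +
      b * (querySpace D).real {p | thresholdQuery a b p.1 false (p.2 - c) = true} =
      ∫ x, (Set.Ico a b).indicator id (x - c) ∂D := by
  rw [measureReal_thresholdQuery hab, measureReal_thresholdQuery hab, ← integral_const_mul,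
    ← integral_const_mul, ← integral_add ((integrable_queryWeight_sub hab c _).const_mul a)
      ((integrable_queryWeight_sub hab c _).const_mul b)]
  congr 1
  ext x
  by_cases hx : x - c ∈ Set.Ico a b
  · have h : b - a ≠ 0 := by linarith
    simp only [queryWeight, Set.indicator_of_mem hx, id, Bool.false_eq_true, if_true, if_false]
    field_simp
    ring
  · simp [queryWeight, Set.indicator_of_notMem hx]

end Region

/-! ### The regions -/

lemma mSeq_add_four (j : ℕ) : mSeq (j + 4) = 6 + 10 * 2 ^ j := by
  induction j with
  | zero => norm_num [mSeq]
  | succ j ih =>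
    have : j + 1 + 4 = (j + 4) + 1 := by ring
    rw [this, mSeq, if_neg (by omega), ih, pow_succ]
    ring

lemma mSeq_succ {i : ℕ} (hi : 5 ≤ i + 1) : mSeq (i + 1) = 2 * (mSeq i - 3) := by
  rw [mSeq, if_neg (by omega)]

lemma mSeq_nonneg (i : ℕ) : 0 ≤ mSeq i := by
  rcases lt_or_ge i 4 with h | h
  · interval_cases i <;> norm_num [mSeq]
  · obtain ⟨j, rfl⟩ := Nat.exists_eq_add_of_le' h
    rw [mSeq_add_four]; positivity

lemma mSeq_lt_succ (i : ℕ) : mSeq i < mSeq (i + 1) := by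
  rcases lt_or_ge i 4 with h | h
  · interval_cases i <;> norm_num [mSeq]
  · obtain ⟨j, rfl⟩ := Nat.exists_eq_add_of_le' h
    rw [show j + 4 + 1 = (j + 1) + 4 by ring, mSeq_add_four, mSeq_add_four, pow_succ]
    have : (0 : ℝ) < 2 ^ j := by positivity
    linarith

lemma regionLeft_lt_regionRight {s : ℝ} (hs : 0 < s) (i : ℕ) (pos : Bool) :
    regionLeft s (i + 1) pos < regionRight s (i + 1) pos := by
  have := mul_lt_mul_of_pos_right (mSeq_lt_succ i) hs
  cases pos <;> simp [regionLeft, regionRight] <;> linarith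

/-- The regions of index at most `N` partition `[-m_N s, m_N s)`. -/
lemma sum_indicator_regions {s : ℝ} (hs : 0 < s) (N : ℕ) (y : ℝ) :
    ∑ i : Fin N, ∑ pos : Bool,
      (Set.Ico (regionLeft s (i + 1) pos) (regionRight s (i + 1) pos)).indicator id y =
      (Set.Ico (-(mSeq N * s)) (mSeq N * s)).indicator id y := by
  induction N with
  | zero => simp [mSeq]
  | succ N ih =>
    have h1 := mul_lt_mul_of_pos_right (mSeq_lt_succ N) hs
    have h2 := mul_nonneg (mSeq_nonneg N) hs.le
    rw [Fin.sum_univ_castSucc]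
    simp only [Fin.val_castSucc, Fin.val_last]
    rw [ih]
    simp only [Fintype.sum_bool, regionLeft, regionRight, Bool.false_eq_true, if_true, if_false,
      add_tsub_cancel_right, Set.indicator_apply, Set.mem_Ico, id]
    split_ifs <;> grind

section Moments

variable {D : Measure ℝ} [IsProbabilityMeasure D] {s c : ℝ}

/-- Chebyshev's inequality for a center within `3 s` of the mean: the regions of index `i ≥ 5` have
probability at most `4 / m_i ^ 2`. -/
lemma measureReal_region_le (hD : MemLp id 2 D) (hs : 0 < s) (hvar : variance id D ≤ s ^ 2)
    (hc : |∫ x, x ∂D - c| ≤ 3 * s) {i : ℕ} (hi : 5 ≤ i + 1) (pos : Bool) :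
    D.real {x | x - c ∈ Set.Ico (regionLeft s (i + 1) pos) (regionRight s (i + 1) pos)} ≤
      4 / mSeq (i + 1) ^ 2 := by
  obtain ⟨j, rfl⟩ := Nat.exists_eq_add_of_le' (show 4 ≤ i by omega)
  have hm : 0 < mSeq (j + 4) - 3 := by
    rw [mSeq_add_four]; have : (0 : ℝ) < 2 ^ j := by positivity
    linarith
  have hr : 0 < (mSeq (j + 4) - 3) * s := mul_pos hm hs
  have h := meas_ge_le_variance_div_sq hD hr
  have hsub : {x | x - c ∈ Set.Ico (regionLeft s (j + 4 + 1) pos) (regionRight s (j + 4 + 1) pos)} ⊆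
      {x | (mSeq (j + 4) - 3) * s ≤ |id x - ∫ x, id x ∂D|} := by
    intro x hx
    simp only [Set.mem_ofPred_eq, id, Set.mem_Ico] at hx ⊢
    rw [abs_le] at hc
    rw [le_abs]
    cases pos <;> simp [regionLeft, regionRight] at hx
    · right; linarith
    · left; linarith
  rw [mSeq_succ hi, measureReal_def]
  have h2 : variance id D / ((mSeq (j + 4) - 3) * s) ^ 2 ≤ 4 / (2 * (mSeq (j + 4) - 3)) ^ 2 := by
    calc variance id D / ((mSeq (j + 4) - 3) * s) ^ 2 ≤ s ^ 2 / ((mSeq (j + 4) - 3) * s) ^ 2 := by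
          gcongr
      _ = 4 / (2 * (mSeq (j + 4) - 3)) ^ 2 := by field_simp; norm_num
  exact ENNReal.toReal_le_of_le_ofReal (by positivity)
    (((measure_mono hsub).trans h).trans (ENNReal.ofReal_le_ofReal h2))

/-- The truncation error: what lies beyond the last region `m_N s` changes the mean by at most
`s ^ 2 * (m_N s) / (m_N s - 3 s) ^ 2 ≤ 1.6 * s / 2 ^ N`. -/
lemma abs_truncation_error_le (hD : MemLp id 2 D) (hs : 0 < s) (hvar : variance id D ≤ s ^ 2)
    (hc : |∫ x, x ∂D - c| ≤ 3 * s) {N : ℕ} (hN : 5 ≤ N) :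
    |c + ∫ x, (Set.Ico (-(mSeq N * s)) (mSeq N * s)).indicator id (x - c) ∂D - ∫ x, x ∂D| ≤
      8 / 5 * s * (1 / 2 ^ N) := by
  obtain ⟨j, rfl⟩ := Nat.exists_eq_add_of_le' (show 4 ≤ N by omega)
  set M := mSeq (j + 4) * s with hM
  set m := ∫ x, x ∂D with hm
  have hj : (0 : ℝ) < 2 ^ j := by positivity
  have ht : 0 < M - 3 * s := by
    rw [hM, mSeq_add_four]; nlinarith
  have hM0 : 0 < M := by linarith
  have hint : Integrable (fun x : ℝ => x) D := hD.integrable (by norm_num)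
  have hint1 : Integrable (fun x => (Set.Ico (-M) M).indicator id (x - c)) D := by
    refine Integrable.of_bound (C := M) ((measurable_id.indicator measurableSet_Ico).comp
      (measurable_id.sub_const c)).aestronglyMeasurable
      (Filter.Eventually.of_forall fun x => ?_)
    by_cases hx : x - c ∈ Set.Ico (-M) M
    · rw [Set.indicator_of_mem hx, Real.norm_eq_abs, id, abs_le]
      exact ⟨hx.1, hx.2.le⟩
    · rw [Set.indicator_of_notMem hx]; simpa using hM0.le
  have hint2 : Integrable (fun x => (x - m) ^ 2) D :=
    (hD.sub (memLp_const m)).integrable_sq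
  have hvar' : variance id D = ∫ x, (x - m) ^ 2 ∂D :=
    variance_eq_integral measurable_id.aemeasurable
  have hpt : ∀ x, ‖(Set.Ico (-M) M).indicator id (x - c) - (x - c)‖ ≤
      M / (M - 3 * s) ^ 2 * (x - m) ^ 2 := by
    intro x
    by_cases hx : x - c ∈ Set.Ico (-M) M
    · rw [Set.indicator_of_mem hx, id, sub_self, norm_zero]; positivity
    rw [Set.indicator_of_notMem hx, zero_sub, norm_neg, Real.norm_eq_abs]
    have hge : M ≤ |x - c| := by
      by_contra! h
      rw [abs_lt] at h
      exact hx ⟨h.1.le, h.2⟩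
    have htri : |x - c| ≤ |x - m| + 3 * s := by
      calc |x - c| = |(x - m) + (m - c)| := by ring_nf
        _ ≤ |x - m| + |m - c| := abs_add_le _ _
        _ ≤ _ := by gcongr
    rw [← sq_abs (x - m), div_mul_eq_mul_div, le_div_iff₀ (by positivity)]
    have h1 : M - 3 * s ≤ |x - m| := by linarith
    -- `|x - m| + 3 s` grows more slowly than `|x - m|` does, hence also than its square
    have h2 : (|x - m| + 3 * s) * (M - 3 * s) ≤ M * |x - m| := by nlinarith
    calc |x - c| * (M - 3 * s) ^ 2 ≤ (|x - m| + 3 * s) * (M - 3 * s) ^ 2 := by gcongr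
      _ = ((|x - m| + 3 * s) * (M - 3 * s)) * (M - 3 * s) := by ring
      _ ≤ (M * |x - m|) * |x - m| := by gcongr
      _ = M * |x - m| ^ 2 := by ring
  have heq : c + ∫ x, (Set.Ico (-M) M).indicator id (x - c) ∂D - m =
      ∫ x, ((Set.Ico (-M) M).indicator id (x - c) - (x - c)) ∂D := by
    have hint3 : Integrable (fun x => x - c) D := hint.sub (integrable_const c)
    rw [integral_sub hint1 hint3, integral_sub hint (integrable_const c)]
    simp
    ring
  rw [heq]
  refine (norm_integral_le_of_norm_le (hint2.const_mul _)
    (Filter.Eventually.of_forall hpt)).trans ?_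
  rw [integral_const_mul, ← hvar']
  calc M / (M - 3 * s) ^ 2 * variance id D ≤ M / (M - 3 * s) ^ 2 * s ^ 2 := by gcongr
    _ ≤ 8 / 5 * s * (1 / 2 ^ (j + 4)) := by
      rw [div_mul_eq_mul_div, div_le_iff₀ (by positivity), hM, mSeq_add_four, pow_add]
      have h3 : 8 / 5 * s * (1 / (2 ^ j * 2 ^ 4)) * ((6 + 10 * 2 ^ j) * s - 3 * s) ^ 2 =
          s ^ 3 * ((3 + 10 * 2 ^ j) ^ 2 / (10 * 2 ^ j)) := by
        field_simp; ring
      rw [h3, show (6 + 10 * 2 ^ j) * s * s ^ 2 = s ^ 3 * (6 + 10 * (2 : ℝ) ^ j) by ring]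
      gcongr
      rw [le_div_iff₀ (by positivity)]
      nlinarith

end Moments

/-! ### The refinement stage for a fixed center -/

lemma iMax_spec {s ε : ℝ} (hs : 0 < s) (hε : 0 < ε) :
    5 ≤ iMax s ε ∧ 1 / 2 ^ iMax s ε ≤ 5 * ε / (128 * s) := by
  have hne : {i : ℕ | 5 ≤ i ∧ (1 : ℝ) / 2 ^ i ≤ 5 * ε / (128 * s)}.Nonempty := by
    obtain ⟨n, hn⟩ := exists_pow_lt_of_lt_one (show 0 < 5 * ε / (128 * s) by positivity)
      (show (1 / 2 : ℝ) < 1 by norm_num)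
    refine ⟨n + 5, by omega, ?_⟩
    rw [← one_div_pow]
    exact (pow_le_pow_of_le_one (by norm_num) (by norm_num) (by omega)).trans hn.le
  exact Nat.sInf_mem hne

lemma iMax_pos {s ε : ℝ} (hs : 0 < s) (hε : 0 < ε) : (0 : ℝ) < iMax s ε := by
  have := (iMax_spec hs hε).1
  exact_mod_cast (by omega : 0 < iMax s ε)

lemma regionAcc_pos {s ε : ℝ} (hs : 0 < s) (hε : 0 < ε) (i : ℕ) :
    0 < regionAcc s ε (i + 1) := by
  have h1 := iMax_pos hs hε
  have h2 := mSeq_nonneg i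
  have h3 := mSeq_lt_succ i
  have h4 : 0 < mSeq i * s + mSeq (i + 1) * s := by nlinarith
  rw [regionAcc, add_tsub_cancel_right]
  positivity

lemma regionConf_pos {s ε δ : ℝ} (hs : 0 < s) (hε : 0 < ε) (hδ : 0 < δ) :
    0 < regionConf s ε δ := by
  have h1 := iMax_pos hs hε
  rw [regionConf]
  positivity

lemma regionConf_lt_two {s ε δ : ℝ} (hs : 0 < s) (hε : 0 < ε) (hδ1 : δ < 1) :
    regionConf s ε δ < 2 := by
  have h1 := iMax_pos hs hε
  have h2 : (5 : ℝ) ≤ iMax s ε := by exact_mod_cast (iMax_spec hs hε).1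
  rw [regionConf, div_lt_iff₀ (by positivity)]
  linarith

section Refinement

variable {D : Measure ℝ} [IsProbabilityMeasure D] {s c ε δ : ℝ}

/-- The answers for one region, when the center is `c`. -/
noncomputable def regionBits (s c ε δ : ℝ) (w : RefIndex s ε δ → ℝ × ℝ)
    (i : Fin (iMax s ε)) (pos left : Bool) (j : Fin (regionSize s ε δ (i + 1))) : Bool :=
  thresholdQuery (regionLeft s (i + 1) pos) (regionRight s (i + 1) pos)
    (w ⟨i, pos, left, j⟩).1 left ((w ⟨i, pos, left, j⟩).2 - c)

/-- The probability of the answer `1` for one region, when the center is `c`. -/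
noncomputable def regionProb (D : Measure ℝ) (s c : ℝ) (i : ℕ) (pos left : Bool) : ℝ :=
  (querySpace D).real {p | thresholdQuery (regionLeft s i pos) (regionRight s i pos)
    p.1 left (p.2 - c) = true}

/-- Each frequency has the required accuracy: by Hoeffding's inequality in the four inner regions,
by Bernstein's inequality and the tail bound on the probability of the region in the others. -/
lemma measureReal_regionAcc_lt_le (hD : MemLp id 2 D) (hs : 0 < s) (hε : 0 < ε) (hδ : 0 < δ)
    (hδ1 : δ < 1) (hvar : variance id D ≤ s ^ 2) (hc : |∫ x, x ∂D - c| ≤ 3 * s)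
    (i : Fin (iMax s ε)) (pos left : Bool) :
    (Measure.pi fun _ : RefIndex s ε δ => querySpace D).real
      {w | regionAcc s ε (i + 1) < |empFreq (regionBits s c ε δ w i pos left) -
        regionProb D s c (i + 1) pos left|} ≤ regionConf s ε δ := by
  have hinj : Function.Injective fun j : Fin (regionSize s ε δ (i + 1)) =>
      (⟨i, pos, left, j⟩ : RefIndex s ε δ) := by
    intro j j' h
    simpa using h
  have hq := measurable_thresholdQuery_sub (regionLeft s (i + 1) pos)
    (regionRight s (i + 1) pos) c left
  have hB : ∀ j, Measurable fun w : RefIndex s ε δ → ℝ × ℝ => regionBits s c ε δ w i pos left j :=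
    fun j => hq.comp (measurable_pi_apply _)
  have hind : iIndepFun (fun j (w : RefIndex s ε δ → ℝ × ℝ) => regionBits s c ε δ w i pos left j)
      (Measure.pi fun _ : RefIndex s ε δ => querySpace D) :=
    (iIndepFun_pi (μ := fun _ : RefIndex s ε δ => querySpace D)
      (X := fun _ p => thresholdQuery (regionLeft s (i + 1) pos)
        (regionRight s (i + 1) pos) p.1 left (p.2 - c)) fun _ => hq.aemeasurable).precomp hinj
  have hp : ∀ j, (Measure.pi fun _ : RefIndex s ε δ => querySpace D).real
      {w | regionBits s c ε δ w i pos left j = true} = regionProb D s c (i + 1) pos left := by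
    intro j
    have hset : MeasurableSet {p : ℝ × ℝ | thresholdQuery (regionLeft s (i + 1) pos)
        (regionRight s (i + 1) pos) p.1 left (p.2 - c) = true} := hq (measurableSet_singleton true)
    exact (measurePreserving_eval (fun _ : RefIndex s ε δ => querySpace D)
      ⟨i, pos, left, j⟩).measureReal_preimage hset.nullMeasurableSet
  by_cases hi : (i : ℕ) + 1 ≤ 4
  · refine measureReal_abs_empFreq_sub_le_of_hoeffding hB hind hp (regionAcc_pos hs hε i)
      (regionConf_pos hs hε hδ) (regionConf_lt_two hs hε hδ1) ?_
    rw [regionSize, if_pos hi]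
    exact Nat.le_ceil _
  · have hm : 0 < mSeq (i + 1) := (mSeq_nonneg i).trans_lt (mSeq_lt_succ i)
    have hq4 : regionProb D s c (i + 1) pos left ≤ 4 / mSeq (i + 1) ^ 2 :=
      (measureReal_thresholdQuery_le (regionLeft_lt_regionRight hs i pos) c left).trans
        (measureReal_region_le hD hs hvar hc (by omega) pos)
    refine measureReal_abs_empFreq_sub_le_of_bernstein hB hind hp (regionAcc_pos hs hε i)
      (by positivity) hq4 (regionConf_pos hs hε hδ) (regionConf_lt_two hs hε hδ1) ?_
    rw [regionSize, if_neg hi]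
    refine le_trans (le_of_eq ?_) (Nat.le_ceil _)
    have := regionAcc_pos hs hε i
    field_simp
    ring

/-- The estimate of the refinement stage, when the center is `c`. -/
noncomputable def refinedEstimate (s c ε δ : ℝ) (w : RefIndex s ε δ → ℝ × ℝ) : ℝ :=
  c + ∑ i : Fin (iMax s ε), ∑ pos : Bool,
    (regionLeft s (i + 1) pos * empFreq (regionBits s c ε δ w i pos true) +
      regionRight s (i + 1) pos * empFreq (regionBits s c ε δ w i pos false))

/-- The estimate has error at most `ε` when every frequency has the required accuracy: one half of
`ε` covers the deviations, the other one the truncation. -/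
lemma abs_refinedEstimate_sub_le (hD : MemLp id 2 D) (hs : 0 < s) (hε : 0 < ε)
    (hvar : variance id D ≤ s ^ 2) (hc : |∫ x, x ∂D - c| ≤ 3 * s) {w : RefIndex s ε δ → ℝ × ℝ}
    (hw : ∀ (i : Fin (iMax s ε)) (pos left : Bool), |empFreq (regionBits s c ε δ w i pos left) -
      regionProb D s c (i + 1) pos left| ≤ regionAcc s ε (i + 1)) :
    |refinedEstimate s c ε δ w - ∫ x, x ∂D| ≤ ε := by
  obtain ⟨hN5, hN⟩ := iMax_spec hs hε
  have hNpos := iMax_pos hs hε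
  have htrunc : |c + ∫ x, (Set.Ico (-(mSeq (iMax s ε) * s)) (mSeq (iMax s ε) * s)).indicator id
      (x - c) ∂D - ∫ x, x ∂D| ≤ ε / 2 := by
    refine (abs_truncation_error_le hD hs hvar hc hN5).trans ?_
    calc 8 / 5 * s * (1 / 2 ^ iMax s ε) ≤ 8 / 5 * s * (5 * ε / (128 * s)) := by gcongr
      _ = ε / 16 := by field_simp; norm_num
      _ ≤ ε / 2 := by linarith
  have hint : ∀ (i : Fin (iMax s ε)) (pos : Bool), Integrable (fun x => (Set.Ico
      (regionLeft s (i + 1) pos) (regionRight s (i + 1) pos)).indicator id (x - c)) D := by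
    intro i pos
    have hab := regionLeft_lt_regionRight hs i pos
    refine Integrable.of_bound
      (C := |regionLeft s (i + 1) pos| + |regionRight s (i + 1) pos|)
      ((measurable_id.indicator measurableSet_Ico).comp
      (measurable_id.sub_const c)).aestronglyMeasurable
      (Filter.Eventually.of_forall fun x => ?_)
    by_cases hx : x - c ∈ Set.Ico (regionLeft s (i + 1) pos) (regionRight s (i + 1) pos)
    · rw [Set.indicator_of_mem hx, Real.norm_eq_abs, id]
      exact (abs_le_max_abs_abs hx.1 hx.2.le).trans (max_le_add_of_nonneg (abs_nonneg _)
        (abs_nonneg _))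
    · rw [Set.indicator_of_notMem hx]; simp only [norm_zero]; positivity
  have hsum : ∫ x, (Set.Ico (-(mSeq (iMax s ε) * s)) (mSeq (iMax s ε) * s)).indicator id
      (x - c) ∂D = ∑ i : Fin (iMax s ε), ∑ pos : Bool,
      (regionLeft s (i + 1) pos * regionProb D s c (i + 1) pos true +
        regionRight s (i + 1) pos * regionProb D s c (i + 1) pos false) := by
    simp_rw [← sum_indicator_regions hs]
    rw [integral_finsetSum _ fun i _ => integrable_finsetSum _ fun pos _ => hint i pos]
    refine Finset.sum_congr rfl fun i _ => ?_
    rw [integral_finsetSum _ fun pos _ => hint i pos]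
    refine Finset.sum_congr rfl fun pos _ => ?_
    exact (endpoint_weighted_measureReal_eq (regionLeft_lt_regionRight hs i pos) c).symm
  have hdev : |refinedEstimate s c ε δ w - (c + ∫ x, (Set.Ico (-(mSeq (iMax s ε) * s))
      (mSeq (iMax s ε) * s)).indicator id (x - c) ∂D)| ≤ ε / 2 := by
    rw [hsum, refinedEstimate, add_sub_add_left_eq_sub, ← Finset.sum_sub_distrib]
    calc _ ≤ ∑ _i : Fin (iMax s ε), ε / (2 * iMax s ε) := by
          refine (Finset.abs_sum_le_sum_abs _ _).trans (Finset.sum_le_sum fun i _ => ?_)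
          rw [← Finset.sum_sub_distrib]
          refine (Finset.abs_sum_le_sum_abs _ _).trans ?_
          have h0 := mSeq_nonneg i
          have h1 := mSeq_lt_succ i
          have h2 : 0 < mSeq i * s + mSeq (i + 1) * s := by nlinarith
          have hbound : ∀ pos : Bool,
              |regionLeft s (i + 1) pos * empFreq (regionBits s c ε δ w i pos true) +
                regionRight s (i + 1) pos * empFreq (regionBits s c ε δ w i pos false) -
              (regionLeft s (i + 1) pos * regionProb D s c (i + 1) pos true +
                regionRight s (i + 1) pos * regionProb D s c (i + 1) pos false)| ≤
              ε / (4 * iMax s ε) := by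
            intro pos
            have habs : |regionLeft s (i + 1) pos| + |regionRight s (i + 1) pos| =
                mSeq i * s + mSeq (i + 1) * s := by
              have h3 : 0 ≤ mSeq i * s := by positivity
              have h4 : 0 ≤ mSeq (i + 1) * s := mul_nonneg (mSeq_nonneg _) hs.le
              cases pos <;> simp [regionLeft, regionRight, abs_of_nonneg h3, abs_of_nonneg h4,
                add_comm, -abs_mul]
            calc _ = |regionLeft s (i + 1) pos * (empFreq (regionBits s c ε δ w i pos true) -
                  regionProb D s c (i + 1) pos true) + regionRight s (i + 1) pos *
                  (empFreq (regionBits s c ε δ w i pos false) -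
                    regionProb D s c (i + 1) pos false)| := by ring_nf
              _ ≤ |regionLeft s (i + 1) pos| * regionAcc s ε (i + 1) +
                  |regionRight s (i + 1) pos| * regionAcc s ε (i + 1) := by
                refine (abs_add_le _ _).trans ?_
                rw [abs_mul, abs_mul]
                gcongr
                · exact hw i pos true
                · exact hw i pos false
              _ = (mSeq i * s + mSeq (i + 1) * s) * regionAcc s ε (i + 1) := by
                rw [← add_mul, habs]
              _ = ε / (4 * iMax s ε) := by
                rw [regionAcc, add_tsub_cancel_right]
                generalize mSeq i * s + mSeq (i + 1) * s = M at h2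
                field_simp
          calc _ ≤ ∑ _pos : Bool, ε / (4 * iMax s ε) := Finset.sum_le_sum fun pos _ => hbound pos
            _ = ε / (2 * iMax s ε) := by simp; field_simp; norm_num
      _ = ε / 2 := by simp; field_simp
  calc _ = |(refinedEstimate s c ε δ w - (c + ∫ x, (Set.Ico (-(mSeq (iMax s ε) * s))
      (mSeq (iMax s ε) * s)).indicator id (x - c) ∂D)) + (c + ∫ x, (Set.Ico
      (-(mSeq (iMax s ε) * s)) (mSeq (iMax s ε) * s)).indicator id (x - c) ∂D - ∫ x, x ∂D)| := by
        ring_nf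
    _ ≤ ε := (abs_add_le _ _).trans (by linarith)

/-- For a center within `3 s` of the mean, the refinement stage fails with probability at most
`δ / 2`. -/
lemma measureReal_refinement_failure_le (hD : MemLp id 2 D) (hs : 0 < s) (hε : 0 < ε) (hδ : 0 < δ)
    (hδ1 : δ < 1) (hvar : variance id D ≤ s ^ 2) (hc : |∫ x, x ∂D - c| ≤ 3 * s) :
    (Measure.pi fun _ : RefIndex s ε δ => querySpace D).real
      {w | ε < |refinedEstimate s c ε δ w - ∫ x, x ∂D|} ≤ δ / 2 := by
  have hsub : {w | ε < |refinedEstimate s c ε δ w - ∫ x, x ∂D|} ⊆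
      ⋃ t : Fin (iMax s ε) × Bool × Bool, {w | regionAcc s ε (t.1 + 1) <
        |empFreq (regionBits s c ε δ w t.1 t.2.1 t.2.2) -
          regionProb D s c (t.1 + 1) t.2.1 t.2.2|} := by
    intro w hw
    by_contra hcon
    simp only [Set.mem_iUnion, Set.mem_ofPred_eq, not_exists, not_lt] at hw hcon
    exact hw.not_ge (abs_refinedEstimate_sub_le hD hs hε hvar hc
      fun i pos left => hcon (i, pos, left))
  refine (measureReal_mono hsub).trans ((measureReal_iUnion_fintype_le _).trans ?_)
  calc _ ≤ ∑ _t : Fin (iMax s ε) × Bool × Bool, regionConf s ε δ :=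
        Finset.sum_le_sum fun t _ =>
          measureReal_regionAcc_lt_le hD hs hε hδ hδ1 hvar hc t.1 t.2.1 t.2.2
    _ = δ / 2 := by
      have := iMax_pos hs hε
      simp [regionConf]
      field_simp
      norm_num

end Refinement

/-! ### The localization stage -/

section Localization

variable {D : Measure ℝ} [IsProbabilityMeasure D] {lam σ δ : ℝ}

/-- The Gray bits decoded by majority vote from the samples of the first stage. -/
noncomputable def decodedBits (lam σ δ : ℝ) (x : LocIndex lam σ δ → ℝ)
    (k : Fin (numGroups lam σ)) : Bool :=
  majority fun j : Fin (groupSize lam σ δ) => grayFun (k + 1) ((x (k, j) + lam) / (2 * lam))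

lemma measurable_grayFun_affine (lam : ℝ) (k : ℕ) :
    Measurable fun x : ℝ => grayFun k ((x + lam) / (2 * lam)) :=
  (measurable_grayFun k).comp (by fun_prop)

lemma measurable_decodedBits : Measurable (decodedBits lam σ δ) := by
  refine measurable_pi_lambda _ fun k => ?_
  exact (measurable_of_countable (majority (J := groupSize lam σ δ))).comp
    (measurable_pi_lambda _ fun j => (measurable_grayFun_affine lam (k + 1)).comp
      (measurable_pi_apply (k, j)))

/-- Chebyshev's inequality: at a level without a switch near the rescaled mean, the bit of a sample
differs from the bit of the mean with probability at most `1 / 4`. -/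
lemma measureReal_grayFun_ne_le (hσ : 0 < σ) (hlam : σ ≤ lam) (hD : MemLp id 2 D)
    (hvar : variance id D ≤ σ ^ 2) (hK : numGroups lam σ ≠ 0) {k : ℕ}
    (hfar : ∀ t : ℤ, 1 / 2 ^ (numGroups lam σ + 2) ≤
      |(∫ x, x ∂D + lam) / (2 * lam) - (2 * t - 1) / 2 ^ k|) :
    D.real {x | grayFun k ((x + lam) / (2 * lam)) ≠
      grayFun k ((∫ x, x ∂D + lam) / (2 * lam))} ≤ 1 / 4 := by
  have hlam0 : 0 < lam := hσ.trans_le hlam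
  have h := meas_ge_le_variance_div_sq hD (show 0 < 2 * σ by positivity)
  have hsub : {x | grayFun k ((x + lam) / (2 * lam)) ≠
      grayFun k ((∫ x, x ∂D + lam) / (2 * lam))} ⊆ {x | 2 * σ ≤ |id x - ∫ x, id x ∂D|} := by
    intro x hx
    by_contra! hcon
    simp only [Set.mem_ofPred_eq, id, not_le] at hcon
    refine hx (grayFun_eq_of_abs_sub_lt hfar ?_)
    rw [← sub_div, add_sub_add_right_eq_sub, abs_div, abs_of_pos (by positivity : 0 < 2 * lam),
      div_lt_iff₀ (by positivity)]
    refine hcon.trans_le ?_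
    rw [one_div_mul_eq_div, le_div_iff₀ (by positivity), pow_add]
    have := two_pow_numGroups_mul_le hσ hlam hK
    linarith
  rw [measureReal_def]
  refine ENNReal.toReal_le_of_le_ofReal (by norm_num)
    (((measure_mono hsub).trans h).trans (ENNReal.ofReal_le_ofReal ?_))
  rw [div_le_iff₀ (by positivity)]
  linarith

/-- The first stage returns a center at distance more than `12 σ` from the mean with probability at
most `δ / 3`. -/
lemma measureReal_localization_failure_le (hσ : 0 < σ) (hlam : σ ≤ lam) (hδ : 0 < δ)
    (hD : MemLp id 2 D) (hvar : variance id D ≤ σ ^ 2) (hmean : |∫ x, x ∂D| ≤ lam) :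
    (Measure.pi fun _ : LocIndex lam σ δ => D).real
      {x | 12 * σ < |∫ x, x ∂D - locCenter lam (numGroups lam σ) (decodedBits lam σ δ x)|} ≤
      δ / 3 := by
  set m := (∫ x, x ∂D + lam) / (2 * lam) with hm
  let far : Fin (numGroups lam σ) → Prop := fun k => ∀ t : ℤ,
    1 / 2 ^ (numGroups lam σ + 2) ≤ |m - (2 * t - 1) / 2 ^ ((k : ℕ) + 1)|
  have hsub : {x | 12 * σ < |∫ x, x ∂D -
      locCenter lam (numGroups lam σ) (decodedBits lam σ δ x)|} ⊆
      ⋃ k, {x | far k ∧ decodedBits lam σ δ x k ≠ grayFun (k + 1) m} := by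
    intro x hx
    by_contra hcon
    simp only [Set.mem_iUnion, Set.mem_ofPred_eq, not_exists, not_and, ne_eq, not_not] at hx hcon
    exact hx.not_ge (abs_sub_locCenter_le hσ hlam hmean fun k hk => hcon k hk)
  have hgroup : ∀ k, (Measure.pi fun _ : LocIndex lam σ δ => D).real
      {x | far k ∧ decodedBits lam σ δ x k ≠ grayFun (k + 1) m} ≤ δ / (3 * numGroups lam σ) := by
    intro k
    have hK : numGroups lam σ ≠ 0 := fun h => absurd k.2 (by omega)
    have hK0 : (0 : ℝ) < numGroups lam σ := by exact_mod_cast Nat.pos_of_ne_zero hK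
    by_cases hfar : far k
    swap
    · simp only [hfar, false_and]
      simp only [Set.ofPred_false, measureReal_empty]
      positivity
    simp only [hfar, true_and]
    have hg := measurable_grayFun_affine lam (k + 1)
    have hinj : Function.Injective fun j : Fin (groupSize lam σ δ) => ((k, j) : LocIndex lam σ δ) :=
      fun j j' h => (Prod.mk.inj h).2
    have hB : ∀ j : Fin (groupSize lam σ δ), Measurable fun x : LocIndex lam σ δ → ℝ =>
        grayFun (k + 1) ((x (k, j) + lam) / (2 * lam)) :=
      fun j => hg.comp (measurable_pi_apply (k, j))
    have hind : iIndepFun (fun (j : Fin (groupSize lam σ δ)) (x : LocIndex lam σ δ → ℝ) =>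
        grayFun (k + 1) ((x (k, j) + lam) / (2 * lam)))
        (Measure.pi fun _ : LocIndex lam σ δ => D) :=
      (iIndepFun_pi (μ := fun _ : LocIndex lam σ δ => D)
        (X := fun _ x => grayFun (k + 1) ((x + lam) / (2 * lam)))
        fun _ => hg.aemeasurable).precomp hinj
    have hlaw : ∀ (j : Fin (groupSize lam σ δ)) (S : Set Bool),
        (Measure.pi fun _ : LocIndex lam σ δ => D).real
          {x | grayFun (k + 1) ((x (k, j) + lam) / (2 * lam)) ∈ S} =
        D.real {x | grayFun (k + 1) ((x + lam) / (2 * lam)) ∈ S} := by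
      intro j S
      have hset : MeasurableSet {x : ℝ | grayFun (k + 1) ((x + lam) / (2 * lam)) ∈ S} :=
        hg (Set.toFinite S).measurableSet
      exact (measurePreserving_eval (fun _ : LocIndex lam σ δ => D)
        (k, j)).measureReal_preimage hset.nullMeasurableSet
    have h := measureReal_majority_ne_le hB hind (fun j => hlaw j {true})
      (g := grayFun (k + 1) m) fun j => (hlaw j {grayFun (k + 1) m}ᶜ).trans_le
        (measureReal_grayFun_ne_le hσ hlam hD hvar hK hfar)
    refine h.trans ?_
    have hJ : 8 * Real.log (3 * numGroups lam σ / δ) ≤ groupSize lam σ δ := Nat.le_ceil _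
    calc Real.exp (-((groupSize lam σ δ : ℝ) / 8))
        ≤ Real.exp (-Real.log (3 * numGroups lam σ / δ)) := Real.exp_le_exp.2 (by linarith)
      _ = δ / (3 * numGroups lam σ) := by
        rw [Real.exp_neg, Real.exp_log (by positivity), inv_div]
  refine (measureReal_mono hsub).trans ((measureReal_iUnion_fintype_le _).trans
    ((Finset.sum_le_sum fun k _ => hgroup k).trans ?_))
  rw [Finset.sum_const, Finset.card_univ, Fintype.card_fin, nsmul_eq_mul]
  rcases Nat.eq_zero_or_pos (numGroups lam σ) with h0 | h0
  · simp only [h0, Nat.cast_zero, zero_mul]; positivity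
  · have : (0 : ℝ) < numGroups lam σ := by exact_mod_cast h0
    apply le_of_eq
    field_simp

end Localization

/-! ### The two stages together -/

section TwoStage

variable {D : Measure ℝ} [IsProbabilityMeasure D] {lam σ ε δ : ℝ}

/-- The samples of the first stage, and for each sample of the second stage the pair of its uniform
variable and its value. -/
def splitSamples {ι κ : Type} (p : (κ → ℝ) × (ι ⊕ κ → ℝ)) : (ι → ℝ) × (κ → ℝ × ℝ) :=
  (fun t => p.2 (Sum.inl t), fun t => (p.1 t, p.2 (Sum.inr t)))

lemma measurePreserving_splitSamples {ι κ : Type} [Fintype ι] [Fintype κ] (U D : Measure ℝ)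
    [IsProbabilityMeasure U] [IsProbabilityMeasure D] :
    MeasurePreserving (splitSamples (ι := ι) (κ := κ))
      ((Measure.pi fun _ : κ => U).prod (Measure.pi fun _ : ι ⊕ κ => D))
      ((Measure.pi fun _ : ι => D).prod (Measure.pi fun _ : κ => U.prod D)) := by
  have h1 := (MeasurePreserving.id (Measure.pi fun _ : κ => U)).prod
    (measurePreserving_sumPiEquivProdPi (fun _ : ι ⊕ κ => D))
  have h2 := (measurePreserving_prodAssoc (Measure.pi fun _ : κ => U) (Measure.pi fun _ : ι => D)
    (Measure.pi fun _ : κ => D)).symm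
  have h3 := (Measure.measurePreserving_swap (μ := Measure.pi fun _ : κ => U)
    (ν := Measure.pi fun _ : ι => D)).prod (MeasurePreserving.id (Measure.pi fun _ : κ => D))
  have h4 := measurePreserving_prodAssoc (Measure.pi fun _ : ι => D) (Measure.pi fun _ : κ => U)
    (Measure.pi fun _ : κ => D)
  have h5 := (MeasurePreserving.id (Measure.pi fun _ : ι => D)).prod
    (measurePreserving_arrowProdEquivProdArrow ℝ ℝ κ (fun _ => U) (fun _ => D)).symm
  exact h5.comp (h4.comp (h3.comp (h2.comp h1)))

lemma answer_inl (u : RefIndex (4 * σ) ε δ → ℝ) (x : SampleIndex lam σ ε δ → ℝ)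
    (k : Fin (numGroups lam σ)) (j : Fin (groupSize lam σ δ)) :
    (twoStageEstimator lam σ ε δ).answer u x (Sum.inl (k, j)) =
      grayFun (k + 1) ((x (Sum.inl (k, j)) + lam) / (2 * lam)) := by
  refine (OneBitEstimator.answer.eq_1 (twoStageEstimator lam σ ε δ) u x _).trans ?_
  rfl

lemma answer_inr (u : RefIndex (4 * σ) ε δ → ℝ) (x : SampleIndex lam σ ε δ → ℝ)
    (i : Fin (iMax (4 * σ) ε)) (pos left : Bool)
    (j : Fin (regionSize (4 * σ) ε δ (i + 1))) :
    (twoStageEstimator lam σ ε δ).answer u x (Sum.inr ⟨i, pos, left, j⟩) =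
      regionBits (4 * σ) (locCenter lam (numGroups lam σ)
        (decodedBits lam σ δ (splitSamples (u, x)).1)) ε δ (splitSamples (u, x)).2
        i pos left j := by
  refine (OneBitEstimator.answer.eq_1 (twoStageEstimator lam σ ε δ) u x _).trans ?_
  have hc : centerOf lam σ ε δ (fun s => if (twoStageEstimator lam σ ε δ).round s <
      (twoStageEstimator lam σ ε δ).round (Sum.inr ⟨i, pos, left, j⟩)
      then (twoStageEstimator lam σ ε δ).answer u x s else false) =
      locCenter lam (numGroups lam σ) (decodedBits lam σ δ (splitSamples (u, x)).1) := by
    rw [centerOf]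
    congr 1
    ext k
    rw [decodedBits]
    congr 1
    ext j
    exact (if_pos (show (0 : ℕ) < 1 from one_pos)).trans (answer_inl u x k j)
  change thresholdQuery _ _ _ _ (_ - centerOf lam σ ε δ _) = _
  rw [hc]
  rfl

/-- The output is the refined estimate around the center computed in the first stage. -/
lemma output_eq_refinedEstimate (u : RefIndex (4 * σ) ε δ → ℝ) (x : SampleIndex lam σ ε δ → ℝ) :
    (twoStageEstimator lam σ ε δ).output u x =
      refinedEstimate (4 * σ) (locCenter lam (numGroups lam σ)
        (decodedBits lam σ δ (splitSamples (u, x)).1)) ε δ (splitSamples (u, x)).2 := by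
  have hc : centerOf lam σ ε δ ((twoStageEstimator lam σ ε δ).answer u x) =
      locCenter lam (numGroups lam σ) (decodedBits lam σ δ (splitSamples (u, x)).1) := by
    rw [centerOf]
    congr 1
    ext k
    rw [decodedBits]
    congr 1
    ext j
    rw [answer_inl]
    rfl
  change twoStageEstimate lam σ ε δ _ = _
  rw [twoStageEstimate, hc, refinedEstimate]
  simp only [answer_inr]

/-- Conditionally on the center, which takes finitely many values, the second stage is a refinement
with a fixed center; its failure probability is at most `δ / 2` whenever the center is good. -/
lemma measureReal_twoStage_failure_le (hσ : 0 < σ) (hlam : σ ≤ lam) (hε : 0 < ε) (hδ : 0 < δ)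
    (hδ1 : δ < 1) (hD : MemLp id 2 D) (hvar : variance id D ≤ σ ^ 2)
    (hmean : |∫ x, x ∂D| ≤ lam) :
    ((Measure.pi fun _ : RefIndex (4 * σ) ε δ => volume.restrict (Set.Icc (0 : ℝ) 1)).prod
      (Measure.pi fun _ : SampleIndex lam σ ε δ => D)).real
      {p | ε < |(twoStageEstimator lam σ ε δ).output p.1 p.2 - ∫ x, x ∂D|} ≤ δ := by
  set μ₁ := Measure.pi fun _ : LocIndex lam σ δ => D with hμ₁
  set μ₂ := Measure.pi fun _ : RefIndex (4 * σ) ε δ => querySpace D with hμ₂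
  let center : (Fin (numGroups lam σ) → Bool) → ℝ := locCenter lam (numGroups lam σ)
  let good : (Fin (numGroups lam σ) → Bool) → Prop := fun z => |∫ x, x ∂D - center z| ≤ 12 * σ
  let fail : (Fin (numGroups lam σ) → Bool) → Set (RefIndex (4 * σ) ε δ → ℝ × ℝ) := fun z =>
    {w | good z ∧ ε < |refinedEstimate (4 * σ) (center z) ε δ w - ∫ x, x ∂D|}
  let A : Set ((LocIndex lam σ δ → ℝ) × (RefIndex (4 * σ) ε δ → ℝ × ℝ)) :=
    ({x | 12 * σ < |∫ x, x ∂D - center (decodedBits lam σ δ x)|} ×ˢ Set.univ) ∪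
      ⋃ z, (decodedBits lam σ δ ⁻¹' {z}) ×ˢ fail z
  have hsub : {p | ε < |(twoStageEstimator lam σ ε δ).output p.1 p.2 - ∫ x, x ∂D|} ⊆
      splitSamples ⁻¹' A := by
    rintro ⟨u, x⟩ hp
    rw [Set.mem_ofPred_eq, output_eq_refinedEstimate] at hp
    by_cases hgood : good (decodedBits lam σ δ (splitSamples (u, x)).1)
    · right
      exact Set.mem_iUnion.2 ⟨_, ⟨rfl, hgood, hp⟩⟩
    · left
      exact ⟨not_le.1 hgood, Set.mem_univ _⟩
  have hfail : ∀ z, μ₂.real (fail z) ≤ δ / 2 := by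
    intro z
    by_cases hz : good z
    · refine (measureReal_mono fun w hw => hw.2).trans
        (measureReal_refinement_failure_le hD (by positivity) hε hδ hδ1 ?_ ?_)
      · nlinarith
      · exact hz.trans (by linarith)
    · have : fail z = ∅ := by ext w; simp [fail, hz]
      rw [this, measureReal_empty]; positivity
  have hsum : ∑ z, μ₁.real (decodedBits lam σ δ ⁻¹' {z}) = 1 := by
    have h := sum_measureReal_preimage_singleton (μ := μ₁) (f := decodedBits lam σ δ)
      Finset.univ fun z _ => measurable_decodedBits (measurableSet_singleton z)
    rw [h]
    simp
  have hA : (μ₁.prod μ₂).real A ≤ δ := by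
    calc (μ₁.prod μ₂).real A ≤ δ / 3 + ∑ z, μ₁.real (decodedBits lam σ δ ⁻¹' {z}) * (δ / 2) := by
          refine (measureReal_union_le _ _).trans (add_le_add ?_ ?_)
          · rw [measureReal_prod_prod, probReal_univ, mul_one]
            exact measureReal_localization_failure_le hσ hlam hδ hD hvar hmean
          · refine (measureReal_iUnion_fintype_le _).trans (Finset.sum_le_sum fun z _ => ?_)
            rw [measureReal_prod_prod]
            gcongr
            exact hfail z
      _ = δ / 3 + δ / 2 := by rw [← Finset.sum_mul, hsum, one_mul]
      _ ≤ δ := by linarith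
  refine (measureReal_mono hsub).trans (le_trans ?_ hA)
  have hmp := measurePreserving_splitSamples (ι := LocIndex lam σ δ) (κ := RefIndex (4 * σ) ε δ)
    (volume.restrict (Set.Icc (0 : ℝ) 1)) D
  rw [measureReal_def, measureReal_def]
  refine ENNReal.toReal_mono (measure_ne_top _ _) ?_
  refine (Measure.le_map_apply hmp.measurable.aemeasurable _).trans_eq ?_
  rw [hmp.map_eq]

theorem isPAC_twoStageEstimator (hσ : 0 < σ) (hlam : σ ≤ lam) (hε : 0 < ε) (hδ : 0 < δ)
    (hδ1 : δ < 1) : (twoStageEstimator lam σ ε δ).IsPAC (meanVarFamily lam σ) ε δ := by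
  rintro D ⟨hprob, hD, hmean, hvar⟩
  set P := (twoStageEstimator lam σ ε δ).law.prod (Measure.pi fun _ : SampleIndex lam σ ε δ => D)
  have h : P.real {p | ε < |(twoStageEstimator lam σ ε δ).output p.1 p.2 - ∫ x, x ∂D|} ≤ δ :=
    measureReal_twoStage_failure_le hσ hlam hε hδ hδ1 hD hvar hmean
  have hcover : (Set.univ : Set ((twoStageEstimator lam σ ε δ).Ω × (SampleIndex lam σ ε δ → ℝ))) ⊆
      {p | |(twoStageEstimator lam σ ε δ).output p.1 p.2 - ∫ x, x ∂D| ≤ ε} ∪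
      {p | ε < |(twoStageEstimator lam σ ε δ).output p.1 p.2 - ∫ x, x ∂D|} :=
    fun p _ => (le_or_gt _ ε : |_| ≤ ε ∨ ε < |_|)
  have h1 := (measureReal_mono (μ := P) hcover).trans (measureReal_union_le _ _)
  rw [probReal_univ] at h1
  refine ENNReal.ofReal_le_of_le_toReal ?_
  rw [← measureReal_def]
  linarith

end TwoStage

/-! ### The number of samples -/

lemma two_pow_iMax_lt {σ ε : ℝ} (hε : 0 < ε) (hεσ : ε ≤ σ) :
    2 ^ iMax (4 * σ) ε < 205 * (σ / ε) := by
  have hσ : 0 < σ := hε.trans_le hεσ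
  have hr : 1 ≤ σ / ε := (one_le_div hε).2 hεσ
  obtain ⟨h5, -⟩ := iMax_spec (show 0 < 4 * σ by positivity) hε
  rcases h5.eq_or_lt with h5 | h5
  · rw [← h5]; linarith
  obtain ⟨N, hN⟩ := Nat.exists_eq_add_of_le' (show 1 ≤ iMax (4 * σ) ε by omega)
  have hnot : N ∉ {i : ℕ | 5 ≤ i ∧ (1 : ℝ) / 2 ^ i ≤ 5 * ε / (128 * (4 * σ))} :=
    Nat.notMem_of_lt_sInf (show N < iMax (4 * σ) ε by omega)
  have h1 : 5 * ε / (128 * (4 * σ)) < 1 / 2 ^ N := by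
    by_contra! h
    exact hnot ⟨by omega, h⟩
  rw [div_lt_div_iff₀ (by positivity) (by positivity)] at h1
  rw [hN, pow_succ, mul_div_assoc', lt_div_iff₀ hε]
  nlinarith

lemma iMax_le {σ ε : ℝ} (hε : 0 < ε) (hεσ : ε ≤ σ) :
    (iMax (4 * σ) ε : ℝ) ≤ 8 * (1 + Real.log (σ / ε)) := by
  have hr : 1 ≤ σ / ε := (one_le_div hε).2 hεσ
  have hl : 0 ≤ Real.log (σ / ε) := Real.log_nonneg hr
  have h1 : (2 : ℝ) ^ iMax (4 * σ) ε ≤ 2 ^ 8 * (σ / ε) := by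
    have := two_pow_iMax_lt hε hεσ
    linarith
  have h2 := Real.log_le_log (by positivity) h1
  rw [Real.log_mul (by positivity) (by positivity), Real.log_pow, Real.log_pow] at h2
  have h3 := Real.log_two_gt_d9
  push_cast at h2
  nlinarith

lemma mSeq_le_two_pow {i : ℕ} (hi : 4 ≤ i) : mSeq i ≤ 2 ^ i := by
  obtain ⟨j, rfl⟩ := Nat.exists_eq_add_of_le' hi
  rw [mSeq_add_four, pow_add]
  have : (1 : ℝ) ≤ 2 ^ j := one_le_pow₀ (by norm_num)
  linarith

lemma log_two_div_regionConf_le {σ ε δ : ℝ} (hε : 0 < ε) (hεσ : ε ≤ σ) (hδ : 0 < δ) (hδ1 : δ < 1) :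
    Real.log (2 / regionConf (4 * σ) ε δ) ≤ 8 * Real.log ((2 + Real.log (σ / ε)) / δ) := by
  have hl : 0 ≤ Real.log (σ / ε) := Real.log_nonneg ((one_le_div hε).2 hεσ)
  have hN := iMax_le hε hεσ
  have hN0 := iMax_pos (show 0 < 4 * σ by linarith) hε
  set y := (2 + Real.log (σ / ε)) / δ with hy
  have hy2 : 2 ≤ y := by rw [hy, le_div_iff₀ hδ]; nlinarith
  rw [show 8 * Real.log y = Real.log (y ^ 8) by rw [Real.log_pow]; norm_num]
  refine Real.log_le_log (by rw [regionConf]; positivity) ?_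
  have h1 : 2 / regionConf (4 * σ) ε δ ≤ 128 * y := by
    rw [regionConf, hy, div_div_eq_mul_div, mul_div_assoc', div_le_div_iff_of_pos_right hδ]
    linarith
  calc _ ≤ 2 ^ 7 * y := by linarith
    _ ≤ y ^ 7 * y := by gcongr
    _ = y ^ 8 := by ring

/-- For `i ≥ 5` the width `m_i s` of the region cancels against its probability, of order
`1 / m_i ^ 2`, so that all regions get `O(i_max ^ 2 (σ / ε) ^ 2)` samples, up to the logarithm. -/
lemma regionSize_le {σ ε δ : ℝ} (hε : 0 < ε) (hεσ : ε ≤ σ) (hδ : 0 < δ) (hδ1 : δ < 1)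
    {i : ℕ} (hi : i < iMax (4 * σ) ε) :
    (regionSize (4 * σ) ε δ (i + 1) : ℝ) ≤
      600000 * ((iMax (4 * σ) ε : ℝ) ^ 2 * (σ / ε) ^ 2 *
        Real.log ((2 + Real.log (σ / ε)) / δ)) := by
  have hσ : 0 < σ := hε.trans_le hεσ
  have hr : 1 ≤ σ / ε := (one_le_div hε).2 hεσ
  have hl : 0 ≤ Real.log (σ / ε) := Real.log_nonneg hr
  have hN1 : (1 : ℝ) ≤ iMax (4 * σ) ε := by
    exact_mod_cast (by omega : 1 ≤ iMax (4 * σ) ε)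
  have hlog := log_two_div_regionConf_le hε hεσ hδ hδ1
  have hpow := two_pow_iMax_lt hε hεσ
  have hlog0 : 0 ≤ Real.log (2 / regionConf (4 * σ) ε δ) := by
    have h1 := regionConf_pos (show 0 < 4 * σ by positivity) hε hδ
    have h2 := regionConf_lt_two (show 0 < 4 * σ by positivity) hε hδ1
    exact Real.log_nonneg ((one_le_div h1).2 h2.le)
  have hL : 1 / 2 ≤ Real.log ((2 + Real.log (σ / ε)) / δ) := by
    have h1 : (2 : ℝ) ≤ (2 + Real.log (σ / ε)) / δ := by rw [le_div_iff₀ hδ]; nlinarith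
    have h2 := Real.log_le_log (by norm_num) h1
    have h3 := Real.log_two_gt_d9
    linarith
  set L := Real.log ((2 + Real.log (σ / ε)) / δ)
  have hm0 := mSeq_nonneg i
  have hm1 := mSeq_lt_succ i
  have hacc : 1 / regionAcc (4 * σ) ε (i + 1) =
      16 * (iMax (4 * σ) ε * (σ / ε)) * (mSeq i + mSeq (i + 1)) := by
    rw [regionAcc, add_tsub_cancel_right, one_div_div]
    field_simp
    ring
  set N : ℝ := (iMax (4 * σ) ε : ℝ) with hN
  set r := σ / ε
  have hNr : 1 ≤ N * r := one_le_mul_of_one_le_of_one_le hN1 hr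
  have hNrL : 1 ≤ 2 * ((N * r) ^ 2 * L) := by
    have : 1 ≤ (N * r) ^ 2 := one_le_pow₀ hNr
    nlinarith
  have key : ∀ E : ℝ, E ≤ 74000 * (N * r) ^ 2 →
      (⌈E * Real.log (2 / regionConf (4 * σ) ε δ)⌉₊ : ℝ) ≤ 600000 * (N ^ 2 * r ^ 2 * L) := by
    intro E hE
    have hub : E * Real.log (2 / regionConf (4 * σ) ε δ) ≤ 74000 * (N * r) ^ 2 * (8 * L) :=
      (mul_le_mul_of_nonneg_right hE hlog0).trans
        (mul_le_mul_of_nonneg_left hlog (by positivity))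
    have h1 : (⌈E * Real.log (2 / regionConf (4 * σ) ε δ)⌉₊ : ℝ) ≤
        74000 * (N * r) ^ 2 * (8 * L) + 1 :=
      (Nat.cast_le.2 (Nat.ceil_mono hub)).trans (Nat.ceil_lt_add_one (by positivity)).le
    have h2 : 74000 * (N * r) ^ 2 * (8 * L) = 592000 * ((N * r) ^ 2 * L) := by ring
    rw [← mul_pow]
    linarith
  rw [regionSize]
  split_ifs with h4
  · have hm24 : mSeq i + mSeq (i + 1) ≤ 24 := by
      have : i ≤ 3 := by omega
      interval_cases i <;> norm_num [mSeq]
    have hm0' : 0 ≤ mSeq i + mSeq (i + 1) := by linarith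
    refine key _ ?_
    rw [show 1 / (2 * regionAcc (4 * σ) ε (i + 1) ^ 2) =
      1 / 2 * (1 / regionAcc (4 * σ) ε (i + 1)) ^ 2 by field_simp, hacc]
    calc 1 / 2 * (16 * (N * r) * (mSeq i + mSeq (i + 1))) ^ 2
        ≤ 1 / 2 * (16 * (N * r) * 24) ^ 2 := by gcongr
      _ ≤ 74000 * (N * r) ^ 2 := by nlinarith [sq_nonneg (N * r)]
  · have hm : 0 < mSeq (i + 1) := hm0.trans_lt hm1
    have hmr : mSeq (i + 1) ≤ 205 * r := by
      refine (mSeq_le_two_pow (by omega)).trans (le_trans ?_ hpow.le)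
      exact pow_le_pow_right₀ (by norm_num) (by omega)
    refine key _ ?_
    rw [← one_div_pow, hacc]
    calc 8 / mSeq (i + 1) ^ 2 * (16 * (N * r) * (mSeq i + mSeq (i + 1))) ^ 2 +
          2 / 3 * (16 * (N * r) * (mSeq i + mSeq (i + 1)))
        ≤ 8 / mSeq (i + 1) ^ 2 * (16 * (N * r) * (2 * mSeq (i + 1))) ^ 2 +
          2 / 3 * (16 * (N * r) * (2 * (205 * r))) := by
          gcongr
          · linarith
          · linarith
      _ = 8192 * (N * r) ^ 2 + 13120 / 3 * (N * r) * r := by field_simp; ring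
      _ ≤ 8192 * (N * r) ^ 2 + 13120 / 3 * (N * r) * (N * r) := by
          gcongr
          nlinarith
      _ ≤ 74000 * (N * r) ^ 2 := by nlinarith [sq_nonneg (N * r)]

lemma numGroups_mul_groupSize_le {lam σ δ : ℝ} (hσ : 0 < σ) (hlam : σ ≤ lam) (hδ : 0 < δ)
    (hδ1 : δ < 1) :
    (numGroups lam σ * groupSize lam σ δ : ℝ) ≤
      36 * (Real.log (lam / σ) * Real.log ((2 + Real.log (lam / σ)) / δ)) := by
  have hl : 0 ≤ Real.log (lam / σ) := Real.log_nonneg ((one_le_div hσ).2 hlam)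
  set l := Real.log (lam / σ) with hldef
  set y := (2 + l) / δ with hy
  have hy2 : 2 ≤ y := by rw [hy, le_div_iff₀ hδ]; nlinarith
  have hlogtwo := Real.log_two_gt_d9
  have hL : 1 / 2 ≤ Real.log y := by
    have := Real.log_le_log (by norm_num) hy2
    linarith
  rcases Nat.eq_zero_or_pos (numGroups lam σ) with h0 | h0
  · rw [h0, Nat.cast_zero, zero_mul]
    positivity
  have hK := two_pow_numGroups_mul_le hσ hlam h0.ne'
  set K := numGroups lam σ with hKdef
  have hK1 : (1 : ℝ) ≤ K := by exact_mod_cast h0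
  have hKl : (K + 2) * Real.log 2 ≤ l := by
    have h1 : (2 : ℝ) ^ (K + 2) ≤ lam / σ := by
      rw [le_div_iff₀ hσ, pow_add]; linarith
    have h2 := Real.log_le_log (by positivity) h1
    rw [Real.log_pow] at h2
    exact_mod_cast h2
  have hK2 : (K : ℝ) ≤ 2 * l := by nlinarith
  have hl2 : 2 ≤ l := by nlinarith
  have hJ : (groupSize lam σ δ : ℝ) ≤ 18 * Real.log y := by
    have h1 : Real.log (3 * K / δ) ≤ 2 * Real.log y := by
      rw [show 2 * Real.log y = Real.log (y ^ 2) by rw [Real.log_pow]; norm_num]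
      refine Real.log_le_log (by positivity) ?_
      have hKsq : 3 * (K : ℝ) ≤ (2 + l) ^ 2 := by nlinarith
      rw [hy, div_pow, div_le_div_iff₀ hδ (by positivity)]
      have hδ2 : δ ^ 2 ≤ δ := by nlinarith
      exact mul_le_mul hKsq hδ2 (by positivity) (by positivity)
    have h2 : (groupSize lam σ δ : ℝ) ≤ 16 * Real.log y + 1 := by
      have h3 : 8 * Real.log (3 * K / δ) ≤ 16 * Real.log y := by linarith
      exact (Nat.cast_le.2 (Nat.ceil_mono h3)).trans (Nat.ceil_lt_add_one (by positivity)).le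
    linarith
  calc (K : ℝ) * groupSize lam σ δ ≤ (2 * l) * (18 * Real.log y) := by gcongr
    _ = 36 * (l * Real.log y) := by ring

lemma numSamples_twoStageEstimator (lam σ ε δ : ℝ) :
    ((twoStageEstimator lam σ ε δ).numSamples : ℝ) =
      numGroups lam σ * groupSize lam σ δ +
        4 * ∑ i : Fin (iMax (4 * σ) ε), (regionSize (4 * σ) ε δ (i + 1) : ℝ) := by
  simp [OneBitEstimator.numSamples, Finset.mul_sum, ← mul_assoc]

/-- The constant is `4 * 600000 * 8 ^ 3`: four frequencies for each `i`, the bound of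
`regionSize_le`, and `i_max ^ 3 ≤ (8 (1 + log (σ / ε))) ^ 3`. -/
theorem numSamples_twoStageEstimator_le {lam σ ε δ : ℝ} (hσ : 0 < σ) (hlam : σ ≤ lam) (hε : 0 < ε)
    (hεσ : ε ≤ σ) (hδ : 0 < δ) (hδ1 : δ < 1) :
    ((twoStageEstimator lam σ ε δ).numSamples : ℝ) ≤
      1228800000 * (σ ^ 2 / ε ^ 2 * (1 + Real.log (σ / ε)) ^ 3 *
          Real.log ((2 + Real.log (σ / ε)) / δ) +
        Real.log (lam / σ) * Real.log ((2 + Real.log (lam / σ)) / δ)) := by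
  have hl : 0 ≤ Real.log (σ / ε) := Real.log_nonneg ((one_le_div hε).2 hεσ)
  have hl' : 0 ≤ Real.log (lam / σ) := Real.log_nonneg ((one_le_div hσ).2 hlam)
  have hL : 0 ≤ Real.log ((2 + Real.log (σ / ε)) / δ) :=
    Real.log_nonneg ((one_le_div hδ).2 (by linarith))
  have hL' : 0 ≤ Real.log ((2 + Real.log (lam / σ)) / δ) :=
    Real.log_nonneg ((one_le_div hδ).2 (by linarith))
  have h1 := numGroups_mul_groupSize_le hσ hlam hδ hδ1
  have hN := iMax_le hε hεσ
  have h2 : ∑ i : Fin (iMax (4 * σ) ε), (regionSize (4 * σ) ε δ (i + 1) : ℝ) ≤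
      307200000 * (σ ^ 2 / ε ^ 2 * (1 + Real.log (σ / ε)) ^ 3 *
        Real.log ((2 + Real.log (σ / ε)) / δ)) := by
    calc _ ≤ ∑ _i : Fin (iMax (4 * σ) ε), 600000 * ((iMax (4 * σ) ε : ℝ) ^ 2 * (σ / ε) ^ 2 *
          Real.log ((2 + Real.log (σ / ε)) / δ)) :=
          Finset.sum_le_sum fun i _ => regionSize_le hε hεσ hδ hδ1 i.2
      _ = 600000 * ((iMax (4 * σ) ε : ℝ) ^ 3 * (σ / ε) ^ 2 *
          Real.log ((2 + Real.log (σ / ε)) / δ)) := by simp; ring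
      _ ≤ 600000 * ((8 * (1 + Real.log (σ / ε))) ^ 3 * (σ / ε) ^ 2 *
          Real.log ((2 + Real.log (σ / ε)) / δ)) := by gcongr
      _ = _ := by rw [div_pow]; ring
  have h3 : 0 ≤ Real.log (lam / σ) * Real.log ((2 + Real.log (lam / σ)) / δ) :=
    mul_nonneg hl' hL'
  rw [numSamples_twoStageEstimator]
  linarith

/-! ### Rounds and queries -/

lemma numRounds_twoStageEstimator_le (lam σ ε δ : ℝ) :
    (twoStageEstimator lam σ ε δ).numRounds ≤ 2 := by
  have hsub : Finset.univ.image (twoStageEstimator lam σ ε δ).round ⊆ {0, 1} := by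
    intro n hn
    obtain ⟨t, -, rfl⟩ := Finset.mem_image.1 hn
    rcases t with t | t <;> simp [twoStageEstimator]
  exact (Finset.card_le_card hsub).trans Finset.card_le_two

/-- A Gray bit of positive level takes the values `1, 0, 1` at three consecutive odd multiples of
`2 ^ (-k)`. -/
lemma not_isIntervalQuery_grayFun {lam : ℝ} (hlam : 0 < lam) (k : ℕ) :
    ¬ IsIntervalQuery fun x => grayFun k ((x + lam) / (2 * lam)) := by
  intro h
  have hval : ∀ n : ℤ, grayFun k ((2 * lam * (n / 2 ^ k) - lam + lam) / (2 * lam)) =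
      decide (n % 4 = 1 ∨ n % 4 = 2) := by
    intro n
    have : (2 : ℝ) ^ k * ((2 * lam * (n / 2 ^ k) - lam + lam) / (2 * lam)) = n := by
      field_simp; ring
    rw [grayFun, this, Int.floor_intCast]
  have hmono : ∀ m n : ℤ, m ≤ n →
      2 * lam * ((m : ℝ) / 2 ^ k) - lam ≤ 2 * lam * ((n : ℝ) / 2 ^ k) - lam := by
    intro m n hmn
    have : (m : ℝ) ≤ n := by exact_mod_cast hmn
    gcongr
  have h3 := h.out (x := 2 * lam * ((1 : ℤ) / 2 ^ k) - lam)
    (y := 2 * lam * ((5 : ℤ) / 2 ^ k) - lam) ((hval 1).trans (by decide))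
    ((hval 5).trans (by decide)) ⟨hmono 1 3 (by norm_num), hmono 3 5 (by norm_num)⟩
  have h4 := (hval 3).symm.trans h3
  exact absurd h4 (by decide)

lemma isIntervalQuery_thresholdQuery (a b u c : ℝ) (left : Bool) :
    IsIntervalQuery fun x => thresholdQuery a b u left (x - c) := by
  refine ⟨fun x hx y hy z hz => ?_⟩
  obtain ⟨h1, h2⟩ := hz
  cases left <;> simp only [thresholdQuery, Bool.false_eq_true, if_true, if_false,
    Set.mem_ofPred_eq, decide_eq_true_eq] at hx hy ⊢ <;> constructor <;> linarith [hx.1, hy.2]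

theorem mainTheorem8 :
    ∃ C : ℝ, 0 < C ∧ ∀ lam σ ε δ : ℝ, 0 < σ → σ ≤ lam → 0 < ε → 0 < δ → δ < 1 →
      (twoStageEstimator lam σ ε δ).IsPAC (meanVarFamily lam σ) ε δ ∧
      (ε ≤ σ →
        ((twoStageEstimator lam σ ε δ).numSamples : ℝ) ≤
          C * (σ ^ 2 / ε ^ 2 * (1 + Real.log (σ / ε)) ^ 3 *
                  Real.log ((2 + Real.log (σ / ε)) / δ) +
               Real.log (lam / σ) * Real.log ((2 + Real.log (lam / σ)) / δ))) ∧
      (twoStageEstimator lam σ ε δ).numRounds ≤ 2 ∧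
      (∀ t, (twoStageEstimator lam σ ε δ).round t = 0 → ∀ ω y,
        ¬ IsIntervalQuery ((twoStageEstimator lam σ ε δ).query t ω y)) ∧
      (∀ t, (twoStageEstimator lam σ ε δ).round t ≠ 0 → ∀ ω y,
        IsIntervalQuery ((twoStageEstimator lam σ ε δ).query t ω y)) := by
  refine ⟨1228800000, by norm_num, fun lam σ ε δ hσ hlam hε hδ hδ1 =>
    ⟨isPAC_twoStageEstimator hσ hlam hε hδ hδ1,
      fun hεσ => numSamples_twoStageEstimator_le hσ hlam hε hεσ hδ hδ1,
      numRounds_twoStageEstimator_le lam σ ε δ, ?_, ?_⟩⟩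
  · rintro (⟨k, j⟩ | t) ht ω y
    · exact not_isIntervalQuery_grayFun (hσ.trans_le hlam) (k + 1)
    · exact absurd ht one_ne_zero
  · rintro (t | ⟨i, pos, left, j⟩) ht ω y
    · exact absurd rfl ht
    · exact isIntervalQuery_thresholdQuery _ _ _ _ left
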